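/- Let $m,n\ge 0$ be integers, let $I\subseteq\{1,\dots,m\}$ be non-empty, let $\pi_1,\dots,\pi_m\in\mathbb R^{n\times n}$ be symmetric positive semidefinite, and let $$A=\begin{pmatrix}A^{\mathcal V}&A^{\mathcal C}\\0&A^{\mathcal D}\end{pmatrix}\in\mathbb R^{(m+n)\times(m+n)},$$ where $A^{\mathcal V}\in\mathbb R^{m\times m}$ is lower triangular with nonnegative off-diagonal entries and strictly negative eigenvalues, and $A^{\mathcal C}\in\mathbb R^{m\times n}$, $A^{\mathcal D}\in\mathbb R^{n\times n}$ are arbitrary. For $y\in\mathbb R^m$, $z\in\mathbb R^n$ and $1\le i\le m$ put $$g_i(z)=\tfrac12 z^\top\pi_i z+(A^{\mathcal C}z)_i,\qquad f_i(y,z)=\tfrac12 y_i^2\,\mathbf 1_{i\in I}+\sum_{k=1}^iA_{ik}y_k+g_i(z).$$ For $T>0$ let $\mathcal S_T$ be the set of all $(v,w)\in\mathbb R^m\times\operatorname{Ker}A^{\mathcal D}$ for which the solution of the Riccati system $\dot y=f(y,w)$, $y(0)=v$, exists on all of $[0,T)$. For $w\in\operatorname{Ker}A^{\mathcal D}$ consider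 the autonomous system on $\mathbb R^{m+1}$ $$\dot x_i=\tfrac T2x_i^2\,\mathbf 1_{i\in I}-x_i+T\sum_{k=1}^iA_{ik}x_kx_{m+1}+Tx_{m+1}^2g_i(w)\quad(1\le i\le m),\qquad \dot x_{m+1}=-x_{m+1},\tag{$*$}$$ which is satisfied by $x_i(s)=e^{-s}y_i(T(1-e^{-s}))$, $x_{m+1}(s)=e^{-s}$. For $\nu\in\mathbb R^m$ let $W^s_\nu(w,T)$ be the set of all $v\in\mathbb R^m$ such that the solution of $(*)$ with $x(0)=(v,1)$ exists for all times $s\ge 0$ and converges to $(\nu,0)$ as $s\to\infty$. Theorem. For each $T>0$, with interior and boundary taken in $\mathbb R^m\times\operatorname{Ker}A^{\mathcal D}$, $$\mathcal S_T^\circ=\bigcup_{w\in\operatorname{Ker}A^{\mathcal D}}W^s_0(w,T)\times\{w\},\qquad \partial\mathcal S_T=\bigcup_{w\in\operatorname{Ker}A^{\mathcal D}}\Big(\bigcup_{\nu\ne0}W^s_\nu(w,T)\Big)\times\{w\},$$ where $\nu$ ranges over the nonzero vectors formed by the first $m$ coordinates of equilibrium points of $(*)$. For every $w\in\operatorname{Ker}A^{\mathcal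 D}$, the equilibrium points of $(*)$ are exactly the points $(\nu,0)$ with $\nu_i\in\{0,2/T\}$ for $i\in I$ and $\nu_i=0$ for $i\notin I$. -/

import Mathlib

/-- Parameters of an affine diffusion on `ℝ₊^m × ℝ^n` in canonical form, as far as they enter the
Riccati equations: the diffusion matrix is `diag(x_I) ⊕ (π₀ + ∑ i, x_i • π i)` and the drift is
`b + B x`. (The parameters `b` and `π₀` do not occur in the equations below.) -/
structure CanonicalAffine (m n : ℕ) where
  /-- the volatility coordinates with a genuine square-root diffusion -/
  I : Finset (Fin m)
  /-- volatility-dependent part of the diffusion matrix of the last `n` coordinates -/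
  π : Fin m → Matrix (Fin n) (Fin n) ℝ
  /-- the linear part of the drift -/
  B : Matrix (Fin m ⊕ Fin n) (Fin m ⊕ Fin n) ℝ
  I_nonempty : I.Nonempty
  π_posSemidef : ∀ i, (π i).PosSemidef
  B_upper_right : B.toBlocks₁₂ = 0
  B_offDiag_nonneg : ∀ i j, i ≠ j → 0 ≤ B.toBlocks₁₁ i j
  B_upperTriangular : B.toBlocks₁₁.BlockTriangular id
  B_eigenvalue_neg :
    ∀ μ : ℝ, Module.End.HasEigenvalue (Matrix.toLin' B.toBlocks₁₁) μ → μ < 0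

namespace CanonicalAffine

variable {m n : ℕ} (P : CanonicalAffine m n)

/-- The matrix `A = Bᵀ`, with blocks `AV`, `AC` (first row of blocks) and `0`, `AD`. -/
def A : Matrix (Fin m ⊕ Fin n) (Fin m ⊕ Fin n) ℝ := P.B.transpose

def AV : Matrix (Fin m) (Fin m) ℝ := P.A.toBlocks₁₁

def AC : Matrix (Fin m) (Fin n) ℝ := P.A.toBlocks₁₂

def AD : Matrix (Fin n) (Fin n) ℝ := P.A.toBlocks₂₂

/-- The kernel of `AD`, a subspace of `ℝ^n`. -/
abbrev kerAD : Submodule ℝ (Fin n → ℝ) := LinearMap.ker (Matrix.toLin' P.AD)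

/-- `g_i(z) = (1/2) zᵀ π_i z + (AC z)_i`. -/
noncomputable def g (z : Fin n → ℝ) (i : Fin m) : ℝ :=
  1 / 2 * (z ⬝ᵥ (P.π i).mulVec z) + P.AC.mulVec z i

/-- The right-hand side of the Riccati system,
`f_i(y, z) = (1/2) y_i² 1_{i ∈ I} + ∑_{k ≤ i} A_{ik} y_k + g_i(z)`. -/
noncomputable def f (y : Fin m → ℝ) (z : Fin n → ℝ) (i : Fin m) : ℝ :=
  (if i ∈ P.I then 1 / 2 * y i ^ 2 else 0) + ∑ k ∈ Finset.Iic i, P.AV i k * y k + P.g z i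

/-- `S_T`: the pairs `(v, w)`, `w ∈ Ker AD`, such that the solution of `y' = f(y, w)`, `y(0) = v`
exists on all of `[0, T)`. -/
def nonexplosionSet (T : ℝ) : Set ((Fin m → ℝ) × P.kerAD) :=
  {u | ∃ y : ℝ → (Fin m → ℝ), y 0 = u.1 ∧
    IsIntegralCurveOn y (fun _ p => P.f p u.2) (Set.Ico 0 T)}

/-- The vector field on `ℝ^m × ℝ` (the second component is `x_{m+1}`) of the time-transformed
system satisfied by `x_i(s) = e^{-s} y_i(T (1 - e^{-s}))`, `x_{m+1}(s) = e^{-s}`. -/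
noncomputable def transformedField (T : ℝ) (w : P.kerAD) (x : (Fin m → ℝ) × ℝ) :
    (Fin m → ℝ) × ℝ :=
  (fun i => (if i ∈ P.I then T / 2 * x.1 i ^ 2 else 0) - x.1 i
      + T * ∑ k ∈ Finset.Iic i, P.AV i k * x.1 k * x.2 + T * x.2 ^ 2 * P.g w i,
    -x.2)

/-- Equilibrium points of the time-transformed system. -/
def equilibria (T : ℝ) (w : P.kerAD) : Set ((Fin m → ℝ) × ℝ) :=
  {x | P.transformedField T w x = 0}

/-- `W^s_ν(w, T)`: the `v` such that the solution of the time-transformed system starting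
at `(v, 1)` exists for all times and converges to `(ν, 0)`. -/
def stableSet (T : ℝ) (w : P.kerAD) (ν : Fin m → ℝ) : Set (Fin m → ℝ) :=
  {v | ∃ x : ℝ → (Fin m → ℝ) × ℝ, x 0 = (v, 1) ∧
    IsIntegralCurveOn x (fun _ p => P.transformedField T w p) (Set.Ici 0) ∧
    Filter.Tendsto x Filter.atTop (nhds (ν, 0))}

end CanonicalAffine

/-! The time change `t = T (1 - e^{-s})` turns solvability on `[0, T)` into global solvability of
the transformed system, and three facts then decide the matter.

(a) Every global transformed solution converges to an equilibrium. The system is triangular and its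
couplings carry factors `e^{-s}`, so by induction each coordinate solves a scalar equation
asymptotic to `u' = (T/2) u² - u` or to `u' = -u` (`exists_tendsto_of_timeField`).

(b) The limit is `0` exactly when the Riccati solution extends to the closed interval `[0, T]`
(`mem_stableSet_zero_iff`). By continuous dependence this is an open condition on the data, so these
points are interior.

(c) If some coordinate of the limit is `2/T`, the point is not interior. Nonnegative off-diagonal
entries preserve the order of solutions. If all initial coordinates are raised slightly and the
solution still exists, the gap in that coordinate grows exponentially, although both solutions
converge (`not_tendsto_of_initial_lt`).

The boundary is then the rest of the set, because the set is closed (`isClosed_solvableSet`):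
solutions are bounded on `[0, T - δ]` uniformly over bounded data (`exists_forall_norm_le`). -/

section

open Set Filter Topology
open scoped NNReal

/-! ### Existence, uniqueness and continuous dependence for locally Lipschitz fields. -/

section LipschitzODE

variable {m : ℕ}

lemma IsIntegralCurveOn.hasDerivWithinAt_Ici_of_Icc {E : Type*} [NormedAddCommGroup E]
    [NormedSpace ℝ E] {y : ℝ → E} {v : ℝ → E → E} {b : ℝ}
    (h : IsIntegralCurveOn y v (Icc 0 b)) {t : ℝ} (ht : t ∈ Ico 0 b) :
    HasDerivWithinAt y (v t (y t)) (Ici t) t := by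
  refine (h t ⟨ht.1, ht.2.le⟩).mono_of_mem_nhdsWithin ?_
  exact mem_of_superset (Icc_mem_nhdsGE ht.2) (Icc_subset_Icc_left ht.1)

/-- The constant inhomogeneity counts as part of the data: later it is `g w`, so one Grönwall
estimate covers perturbations of both `v` and `w`. -/
lemma IsIntegralCurveOn.dist_le_of_lipschitzWith {E : Type*} [NormedAddCommGroup E]
    [NormedSpace ℝ E] {G : E → E} {L : ℝ≥0} (hG : LipschitzWith L G)
    {y z : ℝ → E} {c d : E} {b : ℝ}
    (hy : IsIntegralCurveOn y (fun _ p => G p + c) (Icc 0 b))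
    (hz : IsIntegralCurveOn z (fun _ p => G p + d) (Icc 0 b)) {t : ℝ} (ht : t ∈ Icc 0 b) :
    dist (y t) (z t) ≤ Real.exp ((L + 1) * b) * 2 * dist (y 0, c) (z 0, d) := by
  set D := dist (y 0, c) (z 0, d) with hD
  have hD0 : 0 ≤ D := dist_nonneg
  have h0 : dist (y 0) (z 0) ≤ D := le_max_left _ _
  have h1 : dist c d ≤ D := le_max_right _ _
  -- `z` is an approximate trajectory of the field of `y`, with error at most `D`. The rate `L + 1`
  -- is nonzero and at least 1, so the division by it in Grönwall's bound can be dropped.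
  have key := dist_le_of_approx_trajectories_ODE (K := L + 1) (v := fun _ p => G p + c)
    (f := y) (g := z) (a := 0) (b := b) (εf := 0) (εg := D) (δ := D)
    (fun _ => LipschitzWith.of_dist_le_mul fun p q => by
      rw [dist_add_right]
      refine (hG.dist_le_mul p q).trans ?_
      push_cast
      nlinarith [dist_nonneg (x := p) (y := q)])
    hy.continuousOn (fun t ht => hy.hasDerivWithinAt_Ici_of_Icc ht) (fun t _ => by simp)
    hz.continuousOn (fun t ht => hz.hasDerivWithinAt_Ici_of_Icc ht)
    (fun t _ => by rw [dist_add_left, dist_comm]; exact h1) h0 t ht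
  have hL : (0 : ℝ) < ((L + 1 : ℝ≥0) : ℝ) := by positivity
  rw [gronwallBound_of_K_ne_0 hL.ne'] at key
  refine key.trans ?_
  have hexp : Real.exp (((L + 1 : ℝ≥0) : ℝ) * (t - 0)) ≤ Real.exp ((L + 1) * b) := by
    apply Real.exp_le_exp.2
    push_cast
    have : t ≤ b := ht.2
    rw [sub_zero]
    gcongr
  have hdiv : (0 + D) / ((L + 1 : ℝ≥0) : ℝ) ≤ D := by
    rw [zero_add]
    apply div_le_self hD0
    push_cast
    linarith [L.coe_nonneg]
  have h1e : 1 ≤ Real.exp (((L + 1 : ℝ≥0) : ℝ) * (t - 0)) := by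
    apply Real.one_le_exp
    have : 0 ≤ t := ht.1
    positivity
  have h2 : (0 + D) / ((L + 1 : ℝ≥0) : ℝ) * (Real.exp (((L + 1 : ℝ≥0) : ℝ) * (t - 0)) - 1)
      ≤ D * (Real.exp (((L + 1 : ℝ≥0) : ℝ) * (t - 0)) - 1) :=
    mul_le_mul_of_nonneg_right hdiv (by linarith)
  have h3 := mul_le_mul_of_nonneg_left hexp hD0
  nlinarith

/-- Global solvability of an initial value problem for a bounded Lipschitz vector field. -/
lemma exists_isIntegralCurveOn_Icc_of_lipschitzWith {E : Type*} [NormedAddCommGroup E]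
    [NormedSpace ℝ E] [CompleteSpace E] {G : E → E} {L : ℝ≥0}
    (hG : LipschitzWith L G) {B : ℝ≥0} (hB : ∀ p, ‖G p‖ ≤ B) (v : E) {b : ℝ}
    (hb : 0 ≤ b) : ∃ y : ℝ → E, y 0 = v ∧ IsIntegralCurveOn y (fun _ => G) (Icc 0 b) := by
  -- A curve of speed at most `B` travels at most `B * b` in time `b`; a ball of that radius lets
  -- Picard–Lindelöf reach all of `[0, b]`.
  have hPL : IsPicardLindelof (fun _ => G) (⟨0, left_mem_Icc.2 hb⟩ : Icc (0 : ℝ) b) v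
      (B * b.toNNReal) 0 B L :=
    { lipschitzOnWith := fun _ _ => hG.lipschitzOnWith
      continuousOn := fun _ _ => continuousOn_const
      norm_le := fun _ _ p _ => hB p
      mul_max_le := by simp [hb] }
  exact hPL.exists_eq_forall_mem_Icc_hasDerivWithinAt₀

/-- A locally Lipschitz vector field agrees on any ball with a bounded Lipschitz one. -/
lemma LocallyLipschitz.exists_lipschitzWith_eqOn_ball {F : (Fin m → ℝ) → (Fin m → ℝ)}
    (hF : LocallyLipschitz F) (K : ℝ) : ∃ G : (Fin m → ℝ) → (Fin m → ℝ), ∃ L B : ℝ≥0,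
      LipschitzWith L G ∧ (∀ p, ‖G p‖ ≤ B) ∧ ∀ p, ‖p‖ ≤ K → G p = F p := by
  -- Coordinatewise clamping is a 1-Lipschitz retraction onto the sup-norm ball; `|K|` covers
  -- negative `K`.
  let r : (Fin m → ℝ) → (Fin m → ℝ) := fun p i => max (-|K|) (min |K| (p i))
  have hr : LipschitzWith 1 r := by
    refine LipschitzWith.of_dist_le_mul fun p q => ?_
    rw [NNReal.coe_one, one_mul, dist_pi_le_iff dist_nonneg]
    intro i
    refine le_trans ?_ (dist_le_pi_dist p q i)
    simp only [r, Real.dist_eq]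
    refine (abs_max_sub_max_le_max _ _ _ _).trans (max_le (by simp) ?_)
    exact (abs_min_sub_min_le_max _ _ _ _).trans (by simp)
  have hmem : ∀ p, r p ∈ Metric.closedBall (0 : Fin m → ℝ) |K| := by
    intro p
    rw [mem_closedBall_zero_iff, pi_norm_le_iff_of_nonneg (abs_nonneg _)]
    intro i
    rw [Real.norm_eq_abs, abs_le]
    exact ⟨le_max_left _ _, max_le (by linarith [abs_nonneg K]) (min_le_left _ _)⟩
  have hcomp : IsCompact (Metric.closedBall (0 : Fin m → ℝ) |K|) := isCompact_closedBall _ _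
  obtain ⟨L, hL⟩ := LocallyLipschitzOn.exists_lipschitzOnWith_of_compact hcomp
    (hF.locallyLipschitzOn)
  obtain ⟨B, hB⟩ := hcomp.exists_bound_of_continuousOn hF.continuous.continuousOn
  refine ⟨F ∘ r, L, B.toNNReal, ?_, fun p => (hB _ (hmem p)).trans (Real.le_coe_toNNReal B), ?_⟩
  · have := hL.comp (hr.lipschitzOnWith (s := univ)) (fun p _ => hmem p)
    rwa [mul_one, lipschitzOnWith_univ] at this
  · intro p hp
    simp only [Function.comp]
    congr 1
    ext i
    have h := abs_le.1 ((norm_le_pi_norm p i).trans (hp.trans (le_abs_self K)))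
    simp only [r]
    rw [min_eq_right h.2, max_eq_right h.1]

lemma IsIntegralCurveOn.congr_field {E : Type*} [NormedAddCommGroup E] [NormedSpace ℝ E]
    {y : ℝ → E} {v w : ℝ → E → E} {s : Set ℝ}
    (hy : IsIntegralCurveOn y v s) (h : ∀ t ∈ s, v t (y t) = w t (y t)) :
    IsIntegralCurveOn y w s := fun t ht => h t ht ▸ hy t ht

lemma IsIntegralCurveOn.exists_norm_le {E : Type*} [NormedAddCommGroup E] [NormedSpace ℝ E]
    {y : ℝ → E} {v : ℝ → E → E} {b : ℝ} (hy : IsIntegralCurveOn y v (Icc 0 b)) :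
    ∃ K, ∀ t ∈ Icc 0 b, ‖y t‖ ≤ K :=
  isCompact_Icc.exists_bound_of_continuousOn hy.continuousOn

variable {F : (Fin m → ℝ) → (Fin m → ℝ)}

lemma exists_isIntegralCurveOn_Icc_truncated {G : (Fin m → ℝ) → (Fin m → ℝ)} {L B : ℝ≥0}
    (hL : LipschitzWith L G) (hB : ∀ p, ‖G p‖ ≤ B) (v c : Fin m → ℝ) {b : ℝ} (hb : 0 ≤ b) :
    ∃ z : ℝ → Fin m → ℝ, z 0 = v ∧ IsIntegralCurveOn z (fun _ p => G p + c) (Icc 0 b) := by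
  refine exists_isIntegralCurveOn_Icc_of_lipschitzWith (G := fun p => G p + c) (L := L)
    (B := B + ‖c‖₊) ?_ ?_ v hb
  · simpa using hL.add (LipschitzWith.const c)
  · intro p
    push_cast
    exact (norm_add_le _ _).trans (by gcongr; exact hB p)

/-- The data for which the solution exists on `[0, b]` form an open set. -/
lemma LocallyLipschitz.isOpen_setOf_exists_isIntegralCurveOn_Icc (hF : LocallyLipschitz F)
    {b : ℝ} (hb : 0 ≤ b) :
    IsOpen {p : (Fin m → ℝ) × (Fin m → ℝ) | ∃ y : ℝ → Fin m → ℝ, y 0 = p.1 ∧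
      IsIntegralCurveOn y (fun _ q => F q + p.2) (Icc 0 b)} := by
  rw [Metric.isOpen_iff]
  rintro ⟨v, c⟩ ⟨y, hy0, hy⟩
  simp only at hy0 hy
  obtain ⟨K, hK⟩ := hy.exists_norm_le
  -- The extra 1 in the radius is room: data within `1 / C` move the curve by at most 1, so the
  -- truncated solution stays where `G` equals `F`.
  obtain ⟨G, L, B, hL, hB, hG⟩ := hF.exists_lipschitzWith_eqOn_ball (K + 1)
  set C := Real.exp ((L + 1) * b) * 2 with hC
  have hC0 : 0 < C := by positivity
  refine ⟨1 / C, by positivity, ?_⟩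
  rintro ⟨v', c'⟩ hp
  obtain ⟨z, hz0, hz⟩ := exists_isIntegralCurveOn_Icc_truncated hL hB v' c' hb
  have hyG : IsIntegralCurveOn y (fun _ q => G q + c) (Icc 0 b) :=
    hy.congr_field fun t ht => by
      rw [hG _ ((hK t ht).trans (by linarith))]
  refine ⟨z, hz0, hz.congr_field fun t ht => ?_⟩
  rw [hG]
  have hd := hz.dist_le_of_lipschitzWith hL hyG ht
  rw [hz0, hy0, ← hC] at hd
  have hlt : C * dist (v', c') (v, c) ≤ 1 := by
    have := (mul_lt_mul_of_pos_left (Metric.mem_ball.1 hp) hC0).le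
    rwa [mul_one_div_cancel hC0.ne'] at this
  have : ‖z t‖ ≤ ‖y t‖ + dist (z t) (y t) := by
    rw [dist_eq_norm]
    exact norm_le_norm_add_norm_sub' _ _
  linarith [hK t ht]

/-- A limit of data whose solutions on `[0, b]` are uniformly bounded has a solution on
`[0, b]`. -/
lemma LocallyLipschitz.exists_isIntegralCurveOn_Icc_of_mem_closure (hF : LocallyLipschitz F)
    {b : ℝ} (hb : 0 ≤ b) (K : ℝ) {p : (Fin m → ℝ) × (Fin m → ℝ)}
    (hp : p ∈ closure {p : (Fin m → ℝ) × (Fin m → ℝ) | ∃ y : ℝ → Fin m → ℝ, y 0 = p.1 ∧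
      IsIntegralCurveOn y (fun _ q => F q + p.2) (Icc 0 b) ∧ ∀ t ∈ Icc 0 b, ‖y t‖ ≤ K}) :
    ∃ y : ℝ → Fin m → ℝ, y 0 = p.1 ∧ IsIntegralCurveOn y (fun _ q => F q + p.2) (Icc 0 b) := by
  obtain ⟨v, c⟩ := p
  obtain ⟨G, L, B, hL, hB, hG⟩ := hF.exists_lipschitzWith_eqOn_ball (K + 1)
  set C := Real.exp ((L + 1) * b) * 2 with hC
  have hC0 : 0 < C := by positivity
  rw [Metric.mem_closure_iff] at hp
  obtain ⟨⟨v', c'⟩, ⟨y, hy0, hy, hK⟩, hd⟩ := hp (1 / C) (by positivity)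
  simp only at hy0 hy
  obtain ⟨z, hz0, hz⟩ := exists_isIntegralCurveOn_Icc_truncated hL hB v c hb
  have hyG : IsIntegralCurveOn y (fun _ q => G q + c') (Icc 0 b) :=
    hy.congr_field fun t ht => by
      rw [hG _ ((hK t ht).trans (by linarith))]
  refine ⟨z, hz0, hz.congr_field fun t ht => ?_⟩
  rw [hG]
  have hd' := hz.dist_le_of_lipschitzWith hL hyG ht
  rw [hz0, hy0, ← hC] at hd'
  have hlt : C * dist (v, c) (v', c') ≤ 1 := by
    have := (mul_lt_mul_of_pos_left hd hC0).le
    rwa [mul_one_div_cancel hC0.ne'] at this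
  have : ‖z t‖ ≤ ‖y t‖ + dist (z t) (y t) := by
    rw [dist_eq_norm]
    exact norm_le_norm_add_norm_sub' _ _
  linarith [hK t ht]

lemma LocallyLipschitz.eqOn_of_isIntegralCurveOn_Icc (hF : LocallyLipschitz F) {b : ℝ}
    {y z : ℝ → Fin m → ℝ} {c : Fin m → ℝ}
    (hy : IsIntegralCurveOn y (fun _ q => F q + c) (Icc 0 b))
    (hz : IsIntegralCurveOn z (fun _ q => F q + c) (Icc 0 b)) (h0 : y 0 = z 0) :
    EqOn y z (Icc 0 b) := by
  obtain ⟨K, hK⟩ := hy.exists_norm_le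
  obtain ⟨K', hK'⟩ := hz.exists_norm_le
  obtain ⟨G, L, B, hL, hB, hG⟩ := hF.exists_lipschitzWith_eqOn_ball (max K K')
  have hyG : IsIntegralCurveOn y (fun _ q => G q + c) (Icc 0 b) :=
    hy.congr_field fun t ht => by
      rw [hG _ ((hK t ht).trans (le_max_left _ _))]
  have hzG : IsIntegralCurveOn z (fun _ q => G q + c) (Icc 0 b) :=
    hz.congr_field fun t ht => by
      rw [hG _ ((hK' t ht).trans (le_max_right _ _))]
  intro t ht
  have := hyG.dist_le_of_lipschitzWith hL hzG ht
  rw [h0, dist_self, mul_zero] at this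
  exact dist_le_zero.1 this

/-- Solutions on all `[0, b]` with `b < T` glue to a solution on `[0, T)`. -/
lemma LocallyLipschitz.exists_isIntegralCurveOn_Ico (hF : LocallyLipschitz F) {T : ℝ}
    {v c : Fin m → ℝ}
    (h : ∀ b, 0 ≤ b → b < T → ∃ y : ℝ → Fin m → ℝ, y 0 = v ∧
      IsIntegralCurveOn y (fun _ q => F q + c) (Icc 0 b)) (hT : 0 < T) :
    ∃ y : ℝ → Fin m → ℝ, y 0 = v ∧ IsIntegralCurveOn y (fun _ q => F q + c) (Ico 0 T) := by
  choose Y hY0 hY using h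
  -- The solution up to the midpoint of `t` and `T` lives past `t`, so the glued curve can be
  -- differentiated at `t` by comparison with it.
  have hmid : ∀ t, 0 ≤ t → t < T → 0 ≤ (t + T) / 2 ∧ (t + T) / 2 < T := fun t h1 h2 =>
    ⟨by linarith, by linarith⟩
  have heq : ∀ b b' (hb : 0 ≤ b) (hbT : b < T) (hb' : 0 ≤ b') (hbT' : b' < T) t,
      0 ≤ t → t ≤ b → t ≤ b' → Y b hb hbT t = Y b' hb' hbT' t := by
    intro b b' hb hbT hb' hbT' t ht h1 h2
    exact hF.eqOn_of_isIntegralCurveOn_Icc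
      ((hY b hb hbT).mono (Icc_subset_Icc_right h1))
      ((hY b' hb' hbT').mono (Icc_subset_Icc_right h2)) ((hY0 _ _ _).trans (hY0 _ _ _).symm)
      ⟨ht, le_rfl⟩
  let y : ℝ → Fin m → ℝ := fun t => if ht : 0 ≤ t ∧ t < T then Y t ht.1 ht.2 t else v
  have hyY : ∀ b (hb : 0 ≤ b) (hbT : b < T), ∀ t ∈ Icc 0 b, y t = Y b hb hbT t := by
    intro b hb hbT t ht
    have h' : 0 ≤ t ∧ t < T := ⟨ht.1, ht.2.trans_lt hbT⟩
    simp only [y, dif_pos h']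
    exact heq _ _ _ _ _ _ _ ht.1 le_rfl ht.2
  refine ⟨y, ?_, fun t ht => ?_⟩
  · rw [hyY 0 le_rfl hT 0 ⟨le_rfl, le_rfl⟩, hY0]
  · obtain ⟨h1, h2⟩ := hmid t ht.1 ht.2
    have htm : t ∈ Icc 0 ((t + T) / 2) := ⟨ht.1, by linarith [ht.2]⟩
    have hd := (hY _ h1 h2 t htm).congr (hyY _ h1 h2) (hyY _ h1 h2 t htm)
    simp only [← hyY _ h1 h2 t htm] at hd
    refine hd.mono_of_mem_nhdsWithin ?_
    rw [mem_nhdsWithin]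
    exact ⟨Iio ((t + T) / 2), isOpen_Iio, by simp; linarith [ht.2],
      fun s hs => ⟨hs.2.1, le_of_lt hs.1⟩⟩

/-- A bounded solution on `[0, T)` extends to `[0, T]`. -/
lemma LocallyLipschitz.exists_isIntegralCurveOn_Icc_of_bounded (hF : LocallyLipschitz F) {T : ℝ}
    {v c : Fin m → ℝ} {y : ℝ → Fin m → ℝ} (hT : 0 < T) (hy0 : y 0 = v)
    (hy : IsIntegralCurveOn y (fun _ q => F q + c) (Ico 0 T)) {K : ℝ}
    (hK : ∀ t ∈ Ico 0 T, ‖y t‖ ≤ K) :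
    ∃ y : ℝ → Fin m → ℝ, y 0 = v ∧ IsIntegralCurveOn y (fun _ q => F q + c) (Icc 0 T) := by
  obtain ⟨G, L, B, hL, hB, hG⟩ := hF.exists_lipschitzWith_eqOn_ball K
  obtain ⟨z, hz0, hz⟩ := exists_isIntegralCurveOn_Icc_truncated hL hB v c hT.le
  have hyz : ∀ t ∈ Ico 0 T, z t = y t := by
    intro t ht
    have hyG : IsIntegralCurveOn y (fun _ q => G q + c) (Icc 0 t) :=
      (hy.mono (Icc_subset_Ico_right ht.2)).congr_field fun s hs => by
        rw [hG _ (hK s ⟨hs.1, hs.2.trans_lt ht.2⟩)]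
    have := (hz.mono (Icc_subset_Icc_right ht.2.le)).dist_le_of_lipschitzWith hL hyG
      ⟨ht.1, le_rfl⟩
    rw [hz0, hy0, dist_self, mul_zero] at this
    exact dist_le_zero.1 this
  refine ⟨z, hz0, hz.congr_field fun t ht => ?_⟩
  rw [hG]
  have hcl : ContinuousOn (fun t => ‖z t‖) (closure (Ico 0 T)) := by
    rw [closure_Ico hT.ne]
    exact hz.continuousOn.norm
  have := ContinuousWithinAt.closure_le (f := fun t => ‖z t‖) (g := fun _ => K) (s := Ico 0 T)
    (x := t) (by rwa [closure_Ico hT.ne])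
    ((hz.continuousOn.norm t ht).mono Ico_subset_Icc_self) continuousWithinAt_const
    (fun s hs => by rw [hyz s hs]; exact hK s hs)
  exact this

end LipschitzODE

/-! ### Scalar comparison and asymptotically autonomous Riccati equations. -/

section ScalarODE

variable {u u' : ℝ → ℝ} {S : ℝ}

lemma le_of_hasDerivAt_pos_of_eq {b : ℝ} (hu : ∀ s, S ≤ s → HasDerivAt u (u' s) s)
    (hS : b ≤ u S) (h : ∀ s, S ≤ s → u s = b → 0 < u' s) {s : ℝ} (hs : S ≤ s) : b ≤ u s := by
  have key := image_le_of_deriv_right_lt_deriv_boundary (f := fun t => -u t)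
    (f' := fun t => -u' t) (a := S) (b := s) (B := fun _ => -b) (B' := fun _ => 0)
    (fun t ht => (hu t ht.1).neg.continuousAt.continuousWithinAt)
    (fun t ht => (hu t ht.1).neg.hasDerivWithinAt) (by simpa using hS)
    (fun t => hasDerivAt_const _ _)
    (fun t ht he => by
      have := h t ht.1 (by linarith)
      linarith) ⟨hs, le_rfl⟩
  simpa using key

lemma eventually_le_of_hasDerivAt_ge {b κ : ℝ} (hκ : 0 < κ)
    (hu : ∀ s, S ≤ s → HasDerivAt u (u' s) s) (h : ∀ s, S ≤ s → u s ≤ b → κ ≤ u' s) :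
    ∀ᶠ s in atTop, b ≤ u s := by
  obtain ⟨s₀, hs₀, hb⟩ : ∃ s, S ≤ s ∧ b ≤ u s := by
    by_contra! hcon
    set s := S + (|b - u S| + 1) / κ with hs
    have hSs : S ≤ s := by
      have : 0 ≤ (|b - u S| + 1) / κ := by positivity
      linarith
    have key := image_le_of_deriv_right_le_deriv_boundary (f := fun t => -u t)
      (f' := fun t => -u' t) (a := S) (b := s) (B := fun t => -u S - κ * (t - S))
      (B' := fun _ => -κ)
      (fun t ht => (hu t ht.1).neg.continuousAt.continuousWithinAt)
      (fun t ht => (hu t ht.1).neg.hasDerivWithinAt) (by simp)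
      (by fun_prop)
      (fun t _ => by
        have := (((hasDerivAt_id t).sub_const S).const_mul κ).const_sub (-u S)
        simpa using this.hasDerivWithinAt)
      (fun t ht => neg_le_neg (h t ht.1 (hcon t ht.1).le)) ⟨hSs, le_rfl⟩
    have h1 : κ * (s - S) = |b - u S| + 1 := by
      rw [hs]; field_simp; ring
    have h2 := hcon s hSs
    have h3 := le_abs_self (b - u S)
    linarith
  refine eventually_atTop.2 ⟨s₀, fun s hs => ?_⟩
  exact le_of_hasDerivAt_pos_of_eq (fun t ht => hu t (hs₀.trans ht)) hb
    (fun t ht he => hκ.trans_le (h t (hs₀.trans ht) he.le)) hs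

lemma tendsto_atTop_of_hasDerivAt_ge_mul {κ : ℝ} (hκ : 0 < κ)
    (hu : ∀ s, S ≤ s → HasDerivAt u (u' s) s) (hpos : 0 < u S)
    (h : ∀ s, S ≤ s → 0 < u s → κ * u s ≤ u' s) : Tendsto u atTop atTop := by
  have hge : ∀ s, S ≤ s → u S ≤ u s := fun s hs =>
    le_of_hasDerivAt_pos_of_eq hu le_rfl (fun t ht he => by
      have := h t ht (he ▸ hpos)
      have h2 : 0 < κ * u t := mul_pos hκ (he ▸ hpos)
      linarith) hs
  refine tendsto_atTop.2 fun b => eventually_le_of_hasDerivAt_ge (mul_pos hκ hpos) hu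
    fun s hs _ => ?_
  have h1 := h s hs (hpos.trans_le (hge s hs))
  have h2 := mul_le_mul_of_nonneg_left (hge s hs) hκ.le
  linarith

/-- A function with `u' ≥ κ u²` above the positive level `M` blows up before time
`1 / (κ u(a))` once it has reached that level. -/
lemma mul_sub_lt_inv_of_sq_le_deriv {a b κ M : ℝ} (hab : a ≤ b) (hκ : 0 < κ) (hM : 0 < M)
    (hc : ContinuousOn u (Icc a b)) (hu : ∀ s ∈ Ico a b, HasDerivWithinAt u (u' s) (Ici s) s)
    (ha : M ≤ u a) (h : ∀ s ∈ Ico a b, M ≤ u s → κ * u s ^ 2 ≤ u' s) :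
    κ * (b - a) < (u a)⁻¹ := by
  have hge : ∀ s ∈ Icc a b, M ≤ u s := by
    intro s hs
    have key := image_le_of_deriv_right_lt_deriv_boundary (f := fun t => -u t)
      (f' := fun t => -u' t) (a := a) (b := b) (B := fun _ => -M) (B' := fun _ => 0)
      hc.neg (fun t ht => (hu t ht).neg) (by simpa using ha)
      (fun t => hasDerivAt_const _ _)
      (fun t ht he => by
        have h1 := h t ht (by linarith)
        have h2 : u t = M := by linarith
        have h3 : 0 < κ * u t ^ 2 := by rw [h2]; positivity
        linarith) hs
    simpa using key
  -- The reciprocal falls at rate at least `κ` but must stay positive up to `b`.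
  have key := image_le_of_deriv_right_le_deriv_boundary (f := fun t => (u t)⁻¹)
    (f' := fun t => -u' t / u t ^ 2) (a := a) (b := b) (B := fun t => (u a)⁻¹ - κ * (t - a))
    (B' := fun _ => -κ)
    (hc.inv₀ fun t ht => (hM.trans_le (hge t ht)).ne')
    (fun t ht => (hu t ht).fun_inv (hM.trans_le (hge t ⟨ht.1, ht.2.le⟩)).ne') (by simp)
    (by fun_prop)
    (fun t _ => by
      have := (((hasDerivAt_id t).sub_const a).const_mul κ).const_sub (u a)⁻¹
      simpa using this.hasDerivWithinAt)
    (fun t ht => by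
      have h1 := hge t ⟨ht.1, ht.2.le⟩
      have h2 := h t ht h1
      rw [div_le_iff₀ (by have := hM.trans_le h1; positivity)]
      linarith) ⟨hab, le_rfl⟩
  have : 0 < (u b)⁻¹ := inv_pos.2 (hM.trans_le (hge b ⟨hab, le_rfl⟩))
  linarith

/-- Positivity is preserved by linear differential inequalities. -/
lemma pos_of_mul_le_deriv {b : ℝ} {β : ℝ → ℝ}
    (hc : ContinuousOn u (Icc 0 b)) (hu : ∀ s ∈ Ico 0 b, HasDerivWithinAt u (u' s) (Ici s) s)
    (hβ : ContinuousOn β (Icc 0 b)) (h0 : 0 < u 0) (h : ∀ s ∈ Ico 0 b, β s * u s ≤ u' s)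
    {s : ℝ} (hs : s ∈ Icc 0 b) : 0 < u s := by
  obtain ⟨L, hL⟩ := isCompact_Icc.exists_bound_of_continuousOn hβ
  -- The barrier `u 0 * exp (-(L + 1) t)` decays strictly faster than the bound `|β| ≤ L` permits,
  -- which gives the strict inequality at contact.
  have key := image_le_of_deriv_right_lt_deriv_boundary (f := fun t => -u t)
    (f' := fun t => -u' t) (a := 0) (b := b) (B := fun t => -(u 0 * Real.exp (-(L + 1) * t)))
    (B' := fun t => (L + 1) * (u 0 * Real.exp (-(L + 1) * t)))
    hc.neg (fun t ht => (hu t ht).neg) (by simp)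
    (fun t => by
      have := (((hasDerivAt_id t).const_mul (-(L + 1))).exp.const_mul (u 0)).neg
      refine this.congr_deriv ?_
      simp only [id]
      ring)
    (fun t ht he => by
      have h1 := h t ht
      have h2 : u t = u 0 * Real.exp (-(L + 1) * t) := by linarith
      have h3 : 0 < u t := by rw [h2]; positivity
      have h4 := (abs_le.1 (hL t ⟨ht.1, ht.2.le⟩)).1
      rw [← h2]
      nlinarith) hs
  have : 0 < u 0 * Real.exp (-(L + 1) * s) := by positivity
  linarith

variable {τ : ℝ} {ε δ : ℝ → ℝ}

lemma eventually_neg_le_of_riccati (hτ : 0 ≤ τ) (hε : Tendsto ε atTop (𝓝 0))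
    (hδ : Tendsto δ atTop (𝓝 0))
    (hu : ∀ s, 0 < s → HasDerivAt u (τ * u s ^ 2 - u s + ε s * u s + δ s) s) {η : ℝ}
    (hη : 0 < η) : ∀ᶠ s in atTop, -η ≤ u s := by
  have h1 : ∀ᶠ s in atTop, |ε s| < 1 / 2 := by
    simpa using hε.abs.eventually_lt_const (show |(0 : ℝ)| < 1 / 2 by norm_num)
  have h2 : ∀ᶠ s in atTop, |δ s| < η / 4 := by
    simpa using hδ.abs.eventually_lt_const (show |(0 : ℝ)| < η / 4 by simp; linarith)
  obtain ⟨S, hS⟩ := eventually_atTop.1 ((h1.and h2).and (eventually_gt_atTop 0))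
  -- Below `-η`, `-u + ε u` is at least `η / 2`, and `δ` costs at most `η / 4`.
  refine eventually_le_of_hasDerivAt_ge (S := S) (κ := η / 4) (by linarith)
    (fun s hs => hu s (hS s hs).2) fun s hs hle => ?_
  obtain ⟨⟨h3, h4⟩, -⟩ := hS s hs
  have h5 := (abs_lt.1 h4).1
  have h6 := (abs_lt.1 h3).2
  have h7 : 0 ≤ τ * u s ^ 2 := by positivity
  nlinarith

/-- With `τ = 0` the equation is invariant under sign change, so the lower bound applies to both `u`
and `-u`. -/
lemma tendsto_zero_of_linear (hε : Tendsto ε atTop (𝓝 0)) (hδ : Tendsto δ atTop (𝓝 0))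
    (hu : ∀ s, 0 < s → HasDerivAt u (-u s + ε s * u s + δ s) s) : Tendsto u atTop (𝓝 0) := by
  refine Metric.tendsto_nhds.2 fun η hη => ?_
  have h1 := eventually_neg_le_of_riccati (u := u) le_rfl hε hδ
    (fun s hs => (hu s hs).congr_deriv (by ring)) (half_pos hη)
  have h2 := eventually_neg_le_of_riccati (u := fun s => -u s) (δ := fun s => -δ s) le_rfl hε
    (by simpa using hδ.neg)
    (fun s hs => (hu s hs).neg.congr_deriv (by ring)) (half_pos hη)
  filter_upwards [h1, h2] with s h1 h2
  rw [Real.dist_eq, sub_zero, abs_lt]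
  constructor <;> linarith

/-- Strictly above `τ⁻¹` the quadratic term eventually dominates the perturbations and forces
blow-up in finite time, while `u` is defined for all times. -/
lemma eventually_le_of_riccati (hτ : 0 < τ) (hε : Tendsto ε atTop (𝓝 0))
    (hδ : Tendsto δ atTop (𝓝 0))
    (hu : ∀ s, 0 < s → HasDerivAt u (τ * u s ^ 2 - u s + ε s * u s + δ s) s) {η : ℝ}
    (hη : 0 < η) : ∀ᶠ s in atTop, u s ≤ τ⁻¹ + η := by
  set M := τ⁻¹ + η with hMdef
  have hM : 0 < M := by positivity
  have hτM : 0 < τ * M - 1 := by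
    have : τ * M - 1 = τ * η := by rw [hMdef]; field_simp; ring
    rw [this]; positivity
  -- For `u ≥ M`, `τ u² - u ≥ 2 κ u²`; the perturbations are made to cost at most `κ u²`.
  set κ := (τ * M - 1) / (2 * M) with hκdef
  have hκ : 0 < κ := by positivity
  have hκM : τ * M - 1 = 2 * (κ * M) := by rw [hκdef]; field_simp
  have h1 : ∀ᶠ s in atTop, |ε s| < κ * M / 2 := by
    simpa using hε.abs.eventually_lt_const (show |(0 : ℝ)| < κ * M / 2 by simp; positivity)
  have h2 : ∀ᶠ s in atTop, |δ s| < κ * M ^ 2 / 2 := by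
    simpa using hδ.abs.eventually_lt_const (show |(0 : ℝ)| < κ * M ^ 2 / 2 by simp; positivity)
  obtain ⟨S, hS⟩ := eventually_atTop.1 ((h1.and h2).and (eventually_gt_atTop 0))
  refine eventually_atTop.2 ⟨S, fun s hs => ?_⟩
  by_contra! hcon
  have hpos : 0 < u s := hM.trans hcon
  have key := mul_sub_lt_inv_of_sq_le_deriv (u := u) (a := s) (b := s + (κ * u s)⁻¹)
    (by simp; positivity) hκ hM
    (fun t ht => (hu t ((hS t (hs.trans ht.1)).2)).continuousAt.continuousWithinAt)
    (fun t ht => (hu t ((hS t (hs.trans ht.1)).2)).hasDerivWithinAt) hcon.le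
    (fun t ht hMt => by
      obtain ⟨⟨h3, h4⟩, -⟩ := hS t (hs.trans ht.1)
      have h5 := (abs_lt.1 h4).1
      have h6 := (abs_lt.1 h3).1
      have ht0 : 0 < u t := hM.trans_le hMt
      have h7 : (τ - κ) * u t ≥ (τ - κ) * M := by
        have : 0 ≤ τ - κ := by
          by_contra! hneg
          nlinarith
        exact mul_le_mul_of_nonneg_left hMt this
      have h8 : κ * M ^ 2 / 2 ≤ κ * M * u t / 2 := by
        have := mul_le_mul_of_nonneg_left hMt (mul_pos hκ hM).le
        nlinarith
      have h9 : -(κ * M / 2) * u t ≤ ε t * u t := mul_le_mul_of_nonneg_right h6.le ht0.le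
      have h10 : (1 + κ * M) * u t ≤ (τ - κ) * u t * u t :=
        mul_le_mul_of_nonneg_right (by nlinarith) ht0.le
      nlinarith)
  rw [add_sub_cancel_left, mul_inv, mul_inv_cancel_left₀ hκ.ne'] at key
  exact lt_irrefl _ key

/-- Solutions of the asymptotically autonomous equation `u' = τ u² - u + o(1) u + o(1)` converge
to one of the two equilibria. -/
lemma tendsto_zero_or_inv_of_riccati (hτ : 0 < τ) (hε : Tendsto ε atTop (𝓝 0))
    (hδ : Tendsto δ atTop (𝓝 0))
    (hu : ∀ s, 0 < s → HasDerivAt u (τ * u s ^ 2 - u s + ε s * u s + δ s) s) :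
    Tendsto u atTop (𝓝 0) ∨ Tendsto u atTop (𝓝 τ⁻¹) := by
  by_cases hlow : ∀ η, 0 < η → ∀ᶠ s in atTop, τ⁻¹ - η ≤ u s
  · right
    refine Metric.tendsto_nhds.2 fun η hη => ?_
    filter_upwards [hlow _ (half_pos hη), eventually_le_of_riccati hτ hε hδ hu (half_pos hη)]
      with s h1 h2
    rw [Real.dist_eq, abs_lt]
    constructor <;> linarith
  · left
    push Not at hlow
    obtain ⟨η, hη, hfreq⟩ := hlow
    have hτi : 0 < τ⁻¹ := inv_pos.2 hτ
    -- A positive level strictly below `τ⁻¹` under which `u` dips at arbitrarily late times; after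
    -- one late dip it is trapped below `b` and then pushed to `0`.
    set b := max (τ⁻¹ - η) (τ⁻¹ / 2) with hb
    have hb0 : 0 < b := lt_max_of_lt_right (by positivity)
    have hb1 : 0 < 1 - τ * b := by
      have : b < τ⁻¹ := max_lt (by linarith) (by linarith)
      have := mul_lt_mul_of_pos_left this hτ
      rw [mul_inv_cancel₀ hτ.ne'] at this
      linarith
    have hup : ∀ ζ, 0 < ζ → ζ ≤ b → ∀ᶠ s in atTop, u s ≤ ζ := by
      intro ζ hζ hζb
      -- On `ζ ≤ u ≤ b` one has `u (1 - τ u) ≥ 2 κ`, and the perturbations use up at most `κ`.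
      set κ := ζ * (1 - τ * b) / 2 with hκdef
      have hκ : 0 < κ := by positivity
      have h1 : ∀ᶠ s in atTop, |ε s| < κ / (2 * b) := by
        simpa using hε.abs.eventually_lt_const (show |(0 : ℝ)| < κ / (2 * b) by simp; positivity)
      have h2 : ∀ᶠ s in atTop, |δ s| < κ / 2 := by
        simpa using hδ.abs.eventually_lt_const (show |(0 : ℝ)| < κ / 2 by simp; positivity)
      obtain ⟨S, hS⟩ := eventually_atTop.1 ((h1.and h2).and (eventually_gt_atTop 0))
      have hder : ∀ s, S ≤ s → ζ ≤ u s → u s ≤ b →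
          τ * u s ^ 2 - u s + ε s * u s + δ s ≤ -κ := by
        intro s hs h3 h4
        obtain ⟨⟨h5, h6⟩, -⟩ := hS s hs
        have h7 := (abs_lt.1 h6).2
        have hu0 : 0 < u s := hζ.trans_le h3
        have h8 : ε s * u s ≤ κ / 2 := by
          have : ε s * u s ≤ κ / (2 * b) * b :=
            mul_le_mul (abs_lt.1 h5).2.le h4 hu0.le (by positivity)
          refine this.trans (le_of_eq ?_)
          field_simp
        have h9 : ζ * (1 - τ * b) ≤ u s * (1 - τ * u s) :=
          mul_le_mul h3 (by nlinarith) hb1.le hu0.le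
        have h10 : ζ * (1 - τ * b) = 2 * κ := by rw [hκdef]; ring
        nlinarith
      obtain ⟨s₀, hs₀, hlt⟩ := frequently_atTop.1 hfreq S
      have hle : ∀ s, s₀ ≤ s → u s ≤ b := by
        intro s hs
        have := le_of_hasDerivAt_pos_of_eq (u := fun s => -u s) (b := -b)
          (fun s hs => (hu s (hS s (hs₀.trans hs)).2).neg)
          (neg_le_neg (hlt.le.trans (le_max_left _ _)))
          (fun t ht he => by
            have := hder t (hs₀.trans ht) (by linarith) (by linarith)
            linarith) hs
        linarith
      have := eventually_le_of_hasDerivAt_ge (u := fun s => -u s) (b := -ζ) hκ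
        (fun s hs => (hu s (hS s (hs₀.trans hs)).2).neg)
        (fun t ht he => by
          have := hder t (hs₀.trans ht) (by linarith) (hle t ht)
          linarith)
      filter_upwards [this] with s hs
      linarith
    refine Metric.tendsto_nhds.2 fun ζ hζ => ?_
    filter_upwards [eventually_neg_le_of_riccati hτ.le hε hδ hu (half_pos hζ),
      hup (min (ζ / 2) b) (lt_min (half_pos hζ) hb0) (min_le_right _ _)] with s h1 h2
    have h3 := min_le_left (ζ / 2) b
    rw [Real.dist_eq, sub_zero, abs_lt]
    constructor <;> linarith

end ScalarODE

/-! ### The time change and the asymptotics of the transformed system. -/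

namespace CanonicalAffine

variable {m n : ℕ} (P : CanonicalAffine m n)

/-- The part of the Riccati field that does not depend on the second argument. -/
noncomputable def homField (y : Fin m → ℝ) (i : Fin m) : ℝ :=
  (if i ∈ P.I then 1 / 2 * y i ^ 2 else 0) + ∑ k ∈ Finset.Iic i, P.AV i k * y k

lemma f_eq (y : Fin m → ℝ) (z : Fin n → ℝ) : P.f y z = P.homField y + P.g z := rfl

lemma locallyLipschitz_homField : LocallyLipschitz P.homField := by
  refine ContDiff.locallyLipschitz (𝕂 := ℝ) (contDiff_pi.2 fun i => ?_)
  unfold homField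
  refine ContDiff.add ?_ ?_
  · split_ifs
    · fun_prop
    · exact contDiff_const
  · fun_prop

lemma AV_nonneg {i k : Fin m} (h : k ≠ i) : 0 ≤ P.AV i k := P.B_offDiag_nonneg k i h

lemma sum_Iic_eq (F : Fin m → ℝ) (i : Fin m) :
    ∑ k ∈ Finset.Iic i, F k = F i + ∑ k ∈ Finset.Iio i, F k := by
  rw [← Finset.Iio_insert, Finset.sum_insert (by simp)]

lemma continuous_g : Continuous P.g := by
  refine continuous_pi fun i => ?_
  unfold g
  simp only [dotProduct, Matrix.mulVec]
  fun_prop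

/-- The right-hand side of the first `m` equations of the time-transformed system, as a
nonautonomous field. -/
noncomputable def timeField (T : ℝ) (c : Fin m → ℝ) (s : ℝ) (x : Fin m → ℝ) (i : Fin m) : ℝ :=
  (if i ∈ P.I then T / 2 * x i ^ 2 else 0) - x i
    + T * ∑ k ∈ Finset.Iic i, P.AV i k * x k * Real.exp (-s) + T * Real.exp (-s) ^ 2 * c i

lemma transformedField_eq (T : ℝ) (w : P.kerAD) (x : Fin m → ℝ) (s : ℝ) :
    P.transformedField T w (x, Real.exp (-s)) = (P.timeField T (P.g w) s x, -Real.exp (-s)) := rfl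

variable {P} {T : ℝ} {c : Fin m → ℝ}

lemma snd_eq_exp_neg {w : P.kerAD} {x : ℝ → (Fin m → ℝ) × ℝ} {v : Fin m → ℝ} (h0 : x 0 = (v, 1))
    (hx : IsIntegralCurveOn x (fun _ p => P.transformedField T w p) (Ici 0)) {s : ℝ}
    (hs : 0 ≤ s) : (x s).2 = Real.exp (-s) := by
  have hd : ∀ r ∈ Ici (0 : ℝ), HasDerivWithinAt (fun r => (x r).2 * Real.exp r) 0 (Ici 0) r := by
    intro r hr
    have h1 : HasDerivWithinAt (fun r => (x r).2) (-(x r).2) (Ici 0) r := (hx r hr).snd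
    exact (h1.mul (Real.hasDerivAt_exp r).hasDerivWithinAt).congr_deriv (by ring)
  have hconst := constant_of_derivWithin_zero (f := fun r => (x r).2 * Real.exp r) (a := 0) (b := s)
    (fun r hr => ((hd r hr.1).mono Icc_subset_Ici_self).differentiableWithinAt)
    (fun r hr => by
      have hr' : r ∈ Icc 0 s := ⟨hr.1, hr.2.le⟩
      exact ((hd r hr.1).mono Icc_subset_Ici_self).derivWithin
        (uniqueDiffOn_Icc (hr.1.trans_lt hr.2) r hr')) s ⟨hs, le_rfl⟩
  simp only [h0, Real.exp_zero, mul_one] at hconst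
  rw [Real.exp_neg]
  exact eq_inv_of_mul_eq_one_left hconst

lemma isIntegralCurveOn_fst {w : P.kerAD} {x : ℝ → (Fin m → ℝ) × ℝ} {v : Fin m → ℝ}
    (h0 : x 0 = (v, 1))
    (hx : IsIntegralCurveOn x (fun _ p => P.transformedField T w p) (Ici 0)) :
    IsIntegralCurveOn (fun s => (x s).1) (P.timeField T (P.g w)) (Ici 0) := by
  intro s hs
  have h1 : HasDerivWithinAt (fun s => (x s).1) (P.transformedField T w (x s)).1 (Ici 0) s :=
    (hx s hs).fst
  have h2 : x s = ((x s).1, Real.exp (-s)) := Prod.ext rfl (snd_eq_exp_neg h0 hx hs)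
  rw [h2, transformedField_eq] at h1
  exact h1

lemma isIntegralCurveOn_prod {w : P.kerAD} {X : ℝ → Fin m → ℝ}
    (hX : IsIntegralCurveOn X (P.timeField T (P.g w)) (Ici 0)) :
    IsIntegralCurveOn (fun s => (X s, Real.exp (-s))) (fun _ p => P.transformedField T w p)
      (Ici 0) := by
  intro s hs
  simp only [transformedField_eq]
  refine (hX s hs).prodMk ?_
  have := ((hasDerivAt_id s).neg.exp).hasDerivWithinAt (s := Ici 0)
  exact this.congr_deriv (by simp)

/-- The time change turns a solution of the Riccati system on `[0, T)` into a global one of the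
transformed system. -/
lemma isIntegralCurveOn_timeField_of_riccati {y : ℝ → Fin m → ℝ} (hT : 0 < T)
    (hy : IsIntegralCurveOn y (fun _ q => P.homField q + c) (Ico 0 T)) :
    IsIntegralCurveOn (fun s => Real.exp (-s) • y (T * (1 - Real.exp (-s)))) (P.timeField T c)
      (Ici 0) := by
  intro s hs
  have he : HasDerivWithinAt (fun s => Real.exp (-s)) (-Real.exp (-s)) (Ici 0) s :=
    ((hasDerivAt_id s).neg.exp).hasDerivWithinAt.congr_deriv (by simp)
  have hmaps : MapsTo (fun s => T * (1 - Real.exp (-s))) (Ici 0) (Ico 0 T) := by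
    intro r hr
    have h1 : Real.exp (-r) ≤ 1 := Real.exp_le_one_iff.2 (by simpa using hr)
    have h2 := Real.exp_pos (-r)
    constructor
    · exact mul_nonneg hT.le (by linarith)
    · nlinarith
  have hin : HasDerivWithinAt (fun s => T * (1 - Real.exp (-s))) (T * Real.exp (-s)) (Ici 0) s :=
    ((he.const_sub 1).const_mul T).congr_deriv (by ring)
  have hcomp := (hy _ (hmaps hs)).scomp s hin hmaps
  refine (he.smul hcomp).congr_deriv ?_
  ext i
  simp only [Function.comp, Pi.add_apply, Pi.smul_apply, smul_eq_mul, homField, timeField]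
  have hsum : ∀ (e : ℝ) (z : Fin m → ℝ), ∑ k ∈ Finset.Iic i, P.AV i k * (e * z k) * e
      = e ^ 2 * ∑ k ∈ Finset.Iic i, P.AV i k * z k := by
    intro e z
    rw [Finset.mul_sum]
    exact Finset.sum_congr rfl fun k _ => by ring
  rw [hsum]
  split_ifs <;> ring

/-- The inverse time change. -/
lemma isIntegralCurveOn_riccati_of_timeField {X : ℝ → Fin m → ℝ} (hT : 0 < T)
    (hX : IsIntegralCurveOn X (P.timeField T c) (Ici 0)) :
    IsIntegralCurveOn (fun t => (T / (T - t)) • X (-Real.log ((T - t) / T)))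
      (fun _ q => P.homField q + c) (Ico 0 T) := by
  intro t ht
  have hTt : 0 < T - t := by linarith [ht.2]
  have hmaps : MapsTo (fun t => -Real.log ((T - t) / T)) (Ico 0 T) (Ici 0) := by
    intro r hr
    have h1 : 0 < T - r := by linarith [hr.2]
    simp only [mem_Ici, Left.nonneg_neg_iff]
    exact Real.log_nonpos (by positivity) ((div_le_one hT).2 (by linarith [hr.1]))
  have hsub : HasDerivAt (fun t => T - t) (-1) t := by
    simpa using (hasDerivAt_id t).const_sub T
  have hin : HasDerivWithinAt (fun t => -Real.log ((T - t) / T)) (1 / (T - t)) (Ico 0 T) t := by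
    have := ((hsub.div_const T).log (by positivity)).neg
    refine this.hasDerivWithinAt.congr_deriv ?_
    field_simp
  have hfac : HasDerivWithinAt (fun t => T / (T - t)) (T / (T - t) ^ 2) (Ico 0 T) t := by
    have := (hasDerivAt_const t T).div hsub hTt.ne'
    exact this.hasDerivWithinAt.congr_deriv (by ring)
  have hcomp := (hX _ (hmaps ht)).scomp t hin hmaps
  refine (hfac.smul hcomp).congr_deriv ?_
  ext i
  have hexp : Real.exp (-(-Real.log ((T - t) / T))) = (T - t) / T := by
    rw [neg_neg, Real.exp_log (by positivity)]
  simp only [Function.comp, Pi.add_apply, Pi.smul_apply, smul_eq_mul, homField, timeField, hexp]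
  have hsum : ∀ (e d : ℝ) (z : Fin m → ℝ), ∑ k ∈ Finset.Iic i, P.AV i k * (e * z k)
      = e / d * ∑ k ∈ Finset.Iic i, P.AV i k * z k * d ∨ d = 0 := by
    intro e d z
    by_cases hd : d = 0
    · exact Or.inr hd
    left
    rw [Finset.mul_sum]
    exact Finset.sum_congr rfl fun k _ => by field_simp
  rw [(hsum _ ((T - t) / T) _).resolve_right (by positivity)]
  split_ifs <;> field_simp <;> ring

lemma timeField_hasDerivAt {X : ℝ → Fin m → ℝ}
    (hX : IsIntegralCurveOn X (P.timeField T c) (Ici 0)) {s : ℝ} (hs : 0 < s) (i : Fin m) :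
    HasDerivAt (fun r => X r i) (P.timeField T c s (X s) i) s :=
  hasDerivAt_pi.1 ((hX s hs.le).hasDerivAt (Ici_mem_nhds hs)) i

/-- Every global solution of the transformed system converges to an equilibrium. -/
lemma exists_tendsto_of_timeField {X : ℝ → Fin m → ℝ} (hT : 0 < T)
    (hX : IsIntegralCurveOn X (P.timeField T c) (Ici 0)) :
    ∃ ν : Fin m → ℝ, (∀ i, ν i = 0 ∨ (i ∈ P.I ∧ ν i = 2 / T)) ∧ Tendsto X atTop (𝓝 ν) := by
  have key : ∀ i, ∃ l : ℝ, (l = 0 ∨ (i ∈ P.I ∧ l = 2 / T)) ∧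
      Tendsto (fun s => X s i) atTop (𝓝 l) := by
    intro i
    induction i using WellFoundedLT.induction with
    | ind i ih =>
    have hexp : Tendsto (fun s : ℝ => Real.exp (-s)) atTop (𝓝 0) :=
      Real.tendsto_exp_neg_atTop_nhds_zero
    have hε : Tendsto (fun s : ℝ => T * P.AV i i * Real.exp (-s)) atTop (𝓝 0) := by
      simpa using hexp.const_mul (T * P.AV i i)
    -- The coordinates below `i` converge by induction, so the factor `e^{-s}` makes the whole
    -- coupling vanish.
    have hδ : Tendsto (fun s : ℝ => T * ∑ k ∈ Finset.Iio i, P.AV i k * X s k * Real.exp (-s)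
        + T * Real.exp (-s) ^ 2 * c i) atTop (𝓝 0) := by
      have h1 : Tendsto (fun s : ℝ => ∑ k ∈ Finset.Iio i, P.AV i k * X s k * Real.exp (-s))
          atTop (𝓝 (∑ k ∈ Finset.Iio i, 0)) := by
        refine tendsto_finsetSum _ fun k hk => ?_
        obtain ⟨l, -, hl⟩ := ih k (Finset.mem_Iio.1 hk)
        simpa using (hl.const_mul (P.AV i k)).mul hexp
      have h2 := ((hexp.pow 2).const_mul T).mul_const (c i)
      simpa using (h1.const_mul T).add h2
    by_cases hi : i ∈ P.I
    · have hd : ∀ s, 0 < s → HasDerivAt (fun s => X s i) (T / 2 * X s i ^ 2 - X s i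
          + T * P.AV i i * Real.exp (-s) * X s i
          + (T * ∑ k ∈ Finset.Iio i, P.AV i k * X s k * Real.exp (-s)
            + T * Real.exp (-s) ^ 2 * c i)) s := by
        intro s hs
        refine (timeField_hasDerivAt hX hs i).congr_deriv ?_
        rw [timeField, if_pos hi, sum_Iic_eq]
        ring
      rcases tendsto_zero_or_inv_of_riccati (by positivity) hε hδ hd with h | h
      · exact ⟨0, Or.inl rfl, h⟩
      · exact ⟨(T / 2)⁻¹, Or.inr ⟨hi, inv_div _ _⟩, h⟩
    · have hd : ∀ s, 0 < s → HasDerivAt (fun s => X s i) (-X s i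
          + T * P.AV i i * Real.exp (-s) * X s i
          + (T * ∑ k ∈ Finset.Iio i, P.AV i k * X s k * Real.exp (-s)
            + T * Real.exp (-s) ^ 2 * c i)) s := by
        intro s hs
        refine (timeField_hasDerivAt hX hs i).congr_deriv ?_
        rw [timeField, if_neg hi, sum_Iic_eq]
        ring
      exact ⟨0, Or.inl rfl, tendsto_zero_of_linear hε hδ hd⟩
  choose ν h1 h2 using key
  exact ⟨ν, h1, tendsto_pi_nhds.2 h2⟩

/-- Raising the initial value of a solution that converges to a nonzero equilibrium destroys
global existence. -/
lemma not_tendsto_of_initial_lt {X Z : ℝ → Fin m → ℝ} (hT : 0 < T)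
    (hX : IsIntegralCurveOn X (P.timeField T c) (Ici 0))
    (hZ : IsIntegralCurveOn Z (P.timeField T c) (Ici 0)) (h0 : ∀ i, X 0 i < Z 0 i)
    {ν ν' : Fin m → ℝ} (hXν : Tendsto X atTop (𝓝 ν)) (hZν : Tendsto Z atTop (𝓝 ν'))
    {i : Fin m} (hi : i ∈ P.I) (hν : ν i = 2 / T) : False := by
  -- Factoring `Z² - X²` makes the gap solve a linear equation with coefficient `β`, plus a coupling
  -- that is nonnegative once the earlier gaps are.
  set β : Fin m → ℝ → ℝ := fun i s =>
    (if i ∈ P.I then T / 2 * (Z s i + X s i) else 0) - 1 + T * P.AV i i * Real.exp (-s) with hβ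
  have hXc : ∀ i, ContinuousOn (fun s => X s i) (Ici 0) := fun i =>
    continuousOn_pi.1 hX.continuousOn i
  have hZc : ∀ i, ContinuousOn (fun s => Z s i) (Ici 0) := fun i =>
    continuousOn_pi.1 hZ.continuousOn i
  have hdiff : ∀ s i, P.timeField T c s (Z s) i - P.timeField T c s (X s) i
      = β i s * (Z s i - X s i)
        + T * Real.exp (-s) * ∑ k ∈ Finset.Iio i, P.AV i k * (Z s k - X s k) := by
    intro s i
    have hsum : Real.exp (-s) * ∑ k ∈ Finset.Iio i, P.AV i k * (Z s k - X s k)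
        = ∑ k ∈ Finset.Iio i, P.AV i k * Z s k * Real.exp (-s)
          - ∑ k ∈ Finset.Iio i, P.AV i k * X s k * Real.exp (-s) := by
      rw [Finset.mul_sum, ← Finset.sum_sub_distrib]
      exact Finset.sum_congr rfl fun k _ => by ring
    rw [mul_assoc T, hsum]
    simp only [timeField, hβ, sum_Iic_eq]
    split_ifs <;> ring
  have hpos : ∀ i, ∀ s, 0 ≤ s → 0 < Z s i - X s i := by
    intro i
    induction i using WellFoundedLT.induction with
    | ind i ih =>
    intro s hs
    refine pos_of_mul_le_deriv (u := fun s => Z s i - X s i) (b := s) (β := β i)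
      (((hZc i).sub (hXc i)).mono Icc_subset_Ici_self)
      (fun r hr => ((hasDerivWithinAt_pi.1 (hZ r hr.1) i).mono (Ici_subset_Ici.2 hr.1)).sub
        ((hasDerivWithinAt_pi.1 (hX r hr.1) i).mono (Ici_subset_Ici.2 hr.1))) ?_
      (by simpa using h0 i) ?_ ⟨hs, le_rfl⟩
    · refine ContinuousOn.mono (s := Ici 0) ?_ Icc_subset_Ici_self
      have := hXc i
      have := hZc i
      simp only [hβ]
      split_ifs <;> fun_prop
    · intro r hr
      rw [hdiff]
      refine le_add_of_nonneg_right (mul_nonneg (by positivity) (Finset.sum_nonneg fun k hk => ?_))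
      have hk' := Finset.mem_Iio.1 hk
      exact mul_nonneg (P.AV_nonneg hk'.ne) (ih k hk' r hr.1).le
  have hXi : Tendsto (fun s => X s i) atTop (𝓝 (2 / T)) := hν ▸ tendsto_pi_nhds.1 hXν i
  -- `T X` tends to 2. Since `Z > X`, `β` exceeds `7/4 - 1 - 1/4 = 1/2`, the rate used below.
  have h1 : ∀ᶠ s in atTop, 7 / 4 < T * X s i := by
    have := hXi.const_mul T
    rw [mul_div_cancel₀ _ hT.ne'] at this
    exact this.eventually_const_lt (by norm_num)
  have h2 : ∀ᶠ s in atTop, -(1 / 4) < T * P.AV i i * Real.exp (-s) := by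
    have : Tendsto (fun s : ℝ => T * P.AV i i * Real.exp (-s)) atTop (𝓝 0) := by
      simpa using Real.tendsto_exp_neg_atTop_nhds_zero.const_mul (T * P.AV i i)
    exact this.eventually_const_lt (by norm_num)
  obtain ⟨S, hS⟩ := eventually_atTop.1 ((h1.and h2).and (eventually_gt_atTop 0))
  have hlim : Tendsto (fun s => Z s i - X s i) atTop atTop := by
    refine tendsto_atTop_of_hasDerivAt_ge_mul (κ := 1 / 2) (S := S) (by norm_num)
      (fun s hs => (timeField_hasDerivAt hZ (hS s hs).2 i).sub
        (timeField_hasDerivAt hX (hS s hs).2 i)) (hpos i S (hS S le_rfl).2.le) fun s hs hd => ?_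
    obtain ⟨⟨h3, h4⟩, h5⟩ := hS s hs
    rw [hdiff]
    have h6 : 0 ≤ T * Real.exp (-s) * ∑ k ∈ Finset.Iio i, P.AV i k * (Z s k - X s k) :=
      mul_nonneg (by positivity) (Finset.sum_nonneg fun k hk =>
        mul_nonneg (P.AV_nonneg (Finset.mem_Iio.1 hk).ne) (hpos k s h5.le).le)
    have h7 : 1 / 2 ≤ β i s := by
      simp only [hβ, if_pos hi]
      nlinarith
    have h8 := mul_le_mul_of_nonneg_right h7 hd.le
    linarith
  exact not_tendsto_nhds_of_tendsto_atTop hlim _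
    ((tendsto_pi_nhds.1 hZν i).sub (tendsto_pi_nhds.1 hXν i))

end CanonicalAffine

/-! ### A priori bounds for the Riccati system. -/

/-- Grönwall's inequality with a variable rate on a half-open interval. -/
lemma le_mul_exp_of_deriv_le_mul {q q' Φ φ : ℝ → ℝ} {S T : ℝ}
    (hq : ∀ t ∈ Ico S T, HasDerivWithinAt q (q' t) (Ici t) t) (hc : ContinuousOn q (Ico S T))
    (hΦ : ∀ t ∈ Ico S T, HasDerivAt Φ (φ t) t) (h : ∀ t ∈ Ico S T, q' t ≤ φ t * q t)
    {t : ℝ} (ht : t ∈ Ico S T) : q t ≤ q S * Real.exp (Φ t - Φ S) := by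
  have hsub : Icc S t ⊆ Ico S T := Icc_subset_Ico_right ht.2
  have hsub' : ∀ s ∈ Ico S t, s ∈ Ico S T := fun s hs => hsub ⟨hs.1, hs.2.le⟩
  have key := image_le_of_deriv_right_le_deriv_boundary
    (f := fun s => q s * Real.exp (-Φ s)) (f' := fun s => (q' s - φ s * q s) * Real.exp (-Φ s))
    (a := S) (b := t) (B := fun _ => q S * Real.exp (-Φ S)) (B' := fun _ => 0)
    ((hc.mono hsub).mul fun s hs =>
      (hΦ s (hsub hs)).neg.exp.continuousAt.continuousWithinAt)
    (fun s hs => ((hq s (hsub' s hs)).mul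
      (hΦ s (hsub' s hs)).neg.exp.hasDerivWithinAt).congr_deriv (by
        simp only [Pi.neg_apply]; ring)) le_rfl
    continuousOn_const (fun s _ => hasDerivWithinAt_const _ _ _)
    (fun s hs => mul_nonpos_of_nonpos_of_nonneg (by linarith [h s (hsub' s hs)])
      (Real.exp_pos _).le) ⟨ht.1, le_rfl⟩
  have h2 := mul_le_mul_of_nonneg_right key (Real.exp_pos (Φ t)).le
  rw [mul_assoc, mul_assoc, ← Real.exp_add, ← Real.exp_add, neg_add_cancel, Real.exp_zero,
    mul_one] at h2
  rwa [sub_eq_neg_add]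

namespace CanonicalAffine

variable {m n : ℕ} {P : CanonicalAffine m n} {T : ℝ} {c : Fin m → ℝ} {y : ℝ → Fin m → ℝ}

lemma hasDerivWithinAt_Ici_of_riccati
    (hy : IsIntegralCurveOn y (fun _ q => P.homField q + c) (Ico 0 T)) {t : ℝ}
    (ht : t ∈ Ico 0 T) (i : Fin m) :
    HasDerivWithinAt (fun t => y t i) (P.homField (y t) i + c i) (Ici t) t :=
  hasDerivWithinAt_pi.1 ((hy t ht).mono_of_mem_nhdsWithin
    (mem_of_superset (Ico_mem_nhdsGE ht.2) (Ico_subset_Ico_left ht.1))) i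

lemma continuousOn_apply_of_riccati
    (hy : IsIntegralCurveOn y (fun _ q => P.homField q + c) (Ico 0 T)) (i : Fin m) :
    ContinuousOn (fun t => y t i) (Ico 0 T) :=
  continuousOn_pi.1 hy.continuousOn i

variable (P c) in
/-- A growth rate for the squared norm of solutions. -/
noncomputable def growthRate : ℝ := 2 * ∑ i, (∑ k ∈ Finset.Iic i, |P.AV i k| + |c i|)

lemma growthRate_nonneg : 0 ≤ P.growthRate c := by
  unfold growthRate
  positivity

/-- Only upper bounds on the coordinates are needed, because the cubic term `z i ^ 3` is harmless
when `z i` is negative; the linear and constant terms go into `growthRate`. -/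
lemma two_mul_sum_mul_field_le {z : Fin m → ℝ} {p : ℝ} (hp : ∀ i, z i ≤ p) (hp0 : 0 ≤ p) :
    ∑ i, 2 * z i * (P.homField z i + c i) ≤ (p + P.growthRate c) * (∑ i, z i ^ 2 + 1) := by
  set q := ∑ i, z i ^ 2 + 1 with hq
  have hzq : ∀ i, z i ^ 2 ≤ q - 1 := fun i => by
    have := Finset.single_le_sum (f := fun i => z i ^ 2) (fun i _ => sq_nonneg (z i))
      (Finset.mem_univ i)
    linarith
  have hterm : ∀ i, 2 * z i * (P.homField z i + c i)
      ≤ p * z i ^ 2 + 2 * (∑ k ∈ Finset.Iic i, |P.AV i k| + |c i|) * q := by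
    intro i
    have h1 : z i * (if i ∈ P.I then 1 / 2 * z i ^ 2 else 0) ≤ p * z i ^ 2 / 2 := by
      have h2 := mul_le_mul_of_nonneg_right (hp i) (sq_nonneg (z i))
      have h3 := mul_nonneg hp0 (sq_nonneg (z i))
      split_ifs <;> nlinarith
    have h2 : z i * ∑ k ∈ Finset.Iic i, P.AV i k * z k
        ≤ (∑ k ∈ Finset.Iic i, |P.AV i k|) * q := by
      rw [Finset.mul_sum, Finset.sum_mul]
      refine Finset.sum_le_sum fun k _ => ?_
      have h3 : |z i * z k| ≤ q := by
        rw [abs_mul]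
        nlinarith [hzq i, hzq k, sq_nonneg (|z i| - |z k|), sq_abs (z i), sq_abs (z k)]
      calc z i * (P.AV i k * z k) = P.AV i k * (z i * z k) := by ring
        _ ≤ |P.AV i k * (z i * z k)| := le_abs_self _
        _ = |P.AV i k| * |z i * z k| := abs_mul _ _
        _ ≤ |P.AV i k| * q := by gcongr
    have h3 : z i * c i ≤ |c i| * q := by
      have h4 : |z i| ≤ q := by
        nlinarith [hzq i, sq_nonneg (|z i| - 1), sq_abs (z i)]
      calc z i * c i ≤ |z i * c i| := le_abs_self _
        _ = |c i| * |z i| := by rw [abs_mul, mul_comm]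
        _ ≤ |c i| * q := by gcongr
    simp only [homField]
    linarith
  calc ∑ i, 2 * z i * (P.homField z i + c i)
      ≤ ∑ i, (p * z i ^ 2 + 2 * (∑ k ∈ Finset.Iic i, |P.AV i k| + |c i|) * q) :=
        Finset.sum_le_sum fun i _ => hterm i
    _ = p * (q - 1) + P.growthRate c * q := by
        rw [Finset.sum_add_distrib, ← Finset.mul_sum, ← Finset.sum_mul, growthRate,
          ← Finset.mul_sum]
        congr 2
        rw [hq]; ring
    _ ≤ (p + P.growthRate c) * q := by linarith

/-- A solution on `[0, T)` whose coordinates are eventually at most `1 / (T - t)` is bounded. -/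
lemma exists_norm_le_of_le_inv_sub
    (hy : IsIntegralCurveOn y (fun _ q => P.homField q + c) (Ico 0 T)) {S : ℝ}
    (hS : S ∈ Ico 0 T) (h : ∀ t ∈ Ico S T, ∀ i, y t i ≤ 1 / (T - t)) :
    ∃ K, ∀ t ∈ Ico 0 T, ‖y t‖ ≤ K := by
  set q : ℝ → ℝ := fun t => ∑ i, y t i ^ 2 + 1 with hqdef
  set R := P.growthRate c with hR
  have hR0 : 0 ≤ R := growthRate_nonneg
  have hsub : Ico S T ⊆ Ico 0 T := Ico_subset_Ico_left hS.1
  have hpos : ∀ t ∈ Ico S T, 0 < T - t := fun t ht => by linarith [ht.2]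
  have hq1 : ∀ t, 1 ≤ q t := fun t => by
    have : 0 ≤ ∑ i, y t i ^ 2 := Finset.sum_nonneg fun i _ => sq_nonneg _
    simp only [hqdef]; linarith
  have hsq : ∀ t i, y t i ^ 2 ≤ q t := fun t i => by
    have := Finset.single_le_sum (f := fun i => y t i ^ 2) (fun i _ => sq_nonneg (y t i))
      (Finset.mem_univ i)
    simp only [hqdef]
    linarith
  have hqd : ∀ t ∈ Ico S T, HasDerivWithinAt q (∑ i, 2 * y t i * (P.homField (y t) i + c i))
      (Ici t) t := by
    intro t ht
    have := HasDerivWithinAt.fun_sum (u := Finset.univ) (A := fun i t => y t i ^ 2)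
      fun i _ => (hasDerivWithinAt_Ici_of_riccati hy (hsub ht) i).fun_pow 2
    exact (this.add_const 1).congr_deriv (Finset.sum_congr rfl fun i _ => by simp)
  have hqc : ContinuousOn q (Ico S T) := by
    refine ContinuousOn.mono ?_ hsub
    exact (continuousOn_finsetSum _ fun i _ =>
      (continuousOn_apply_of_riccati hy i).pow 2).add continuousOn_const
  have hTd : ∀ t, HasDerivAt (fun t => T - t) (-1) t := fun t => by
    simpa using (hasDerivAt_id t).const_sub T
  set D := q S * (T - S) * Real.exp (R * (T - S)) with hD
  have hTS := hpos S ⟨le_rfl, hS.2⟩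
  have hqS := hq1 S
  have hD0 : 0 < D := by positivity
  -- The rate `1 / (T - t)` integrates to a logarithm, so the squared norm grows at most like `1 /
  -- (T - t)`.
  have hstep1 : ∀ t ∈ Ico S T, q t ≤ D / (T - t) := by
    intro t ht
    have key := le_mul_exp_of_deriv_le_mul (Φ := fun t => -Real.log (T - t) + R * t)
      (φ := fun t => 1 / (T - t) + R) hqd hqc
      (fun t ht => by
        have := ((hTd t).log (hpos t ht).ne').neg.add ((hasDerivAt_id t).const_mul R)
        exact this.congr_deriv (by simp [neg_div]))
      (fun t ht => two_mul_sum_mul_field_le (h t ht) (one_div_pos.2 (hpos t ht)).le) ht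
    refine key.trans ?_
    have hTt := hpos t ht
    have : -Real.log (T - t) + R * t - (-Real.log (T - S) + R * S)
        = Real.log ((T - S) / (T - t)) + R * (t - S) := by
      rw [Real.log_div hTS.ne' hTt.ne']; ring
    rw [this, Real.exp_add, Real.exp_log (by positivity), hD]
    have h3 : Real.exp (R * (t - S)) ≤ Real.exp (R * (T - S)) :=
      Real.exp_le_exp.2 (mul_le_mul_of_nonneg_left (by linarith [ht.2]) hR0)
    calc q S * ((T - S) / (T - t) * Real.exp (R * (t - S)))
        ≤ q S * ((T - S) / (T - t) * Real.exp (R * (T - S))) := by gcongr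
      _ = q S * (T - S) * Real.exp (R * (T - S)) / (T - t) := by ring
  have hstep2 : ∀ t ∈ Ico S T, ∀ i, y t i ≤ √D / √(T - t) := by
    intro t ht i
    rw [← Real.sqrt_div hD0.le]
    exact Real.le_sqrt_of_sq_le ((hsq t i).trans (hstep1 t ht))
  set Q := q S * Real.exp (2 * √D * √(T - S) + R * (T - S)) with hQ
  -- The coordinates are now of order `(T - t)^{-1/2}`, an integrable rate, so a second Grönwall
  -- argument gives boundedness.
  have hstep3 : ∀ t ∈ Ico S T, q t ≤ Q := by
    intro t ht
    have key := le_mul_exp_of_deriv_le_mul (Φ := fun t => -(2 * √D) * √(T - t) + R * t)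
      (φ := fun t => √D / √(T - t) + R) hqd hqc
      (fun t ht => by
        have := (((hTd t).sqrt (hpos t ht).ne').const_mul (-(2 * √D))).add
          ((hasDerivAt_id t).const_mul R)
        refine this.congr_deriv ?_
        have := Real.sqrt_pos.2 (hpos t ht)
        field_simp)
      (fun t ht => two_mul_sum_mul_field_le (hstep2 t ht) (by positivity)) ht
    refine key.trans ?_
    rw [hQ]
    refine mul_le_mul_of_nonneg_left (Real.exp_le_exp.2 ?_) (by linarith)
    have h1 : 0 ≤ 2 * √D * √(T - t) := by positivity
    have h2 : R * (t - S) ≤ R * (T - S) := mul_le_mul_of_nonneg_left (by linarith [ht.2]) hR0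
    linarith
  obtain ⟨K, hK⟩ := (isCompact_Icc (a := (0 : ℝ)) (b := S)).exists_bound_of_continuousOn
    (hy.continuousOn.mono (Icc_subset_Ico_right hS.2))
  refine ⟨max K Q, fun t ht => ?_⟩
  rcases le_total t S with hle | hle
  · exact (hK t ⟨ht.1, hle⟩).trans (le_max_left _ _)
  · refine le_trans ?_ (le_max_right _ _)
    have h1 := hstep3 t ⟨hle, ht.2⟩
    have h2 := hq1 t
    rw [pi_norm_le_iff_of_nonneg (by linarith)]
    intro i
    rw [Real.norm_eq_abs]
    nlinarith [hsq t i, sq_abs (y t i), sq_nonneg (|y t i| - 1)]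

variable (P) in
/-- A bound for the row sums of the drift matrix. -/
noncomputable def rowBound : ℝ := ∑ i, ∑ k ∈ Finset.Iic i, |P.AV i k|

lemma rowBound_nonneg : 0 ≤ P.rowBound := by
  unfold rowBound
  positivity

lemma sum_Iic_mul_le_rowBound_mul {z : Fin m → ℝ} {i : Fin m} {p : ℝ} (hp : 0 ≤ p)
    (h : ∀ k ∈ Finset.Iic i, P.AV i k * z k ≤ |P.AV i k| * p) :
    ∑ k ∈ Finset.Iic i, P.AV i k * z k ≤ P.rowBound * p := by
  refine (Finset.sum_le_sum h).trans ?_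
  rw [← Finset.sum_mul]
  refine mul_le_mul_of_nonneg_right ?_ hp
  exact Finset.single_le_sum (f := fun i => ∑ k ∈ Finset.Iic i, |P.AV i k|)
    (fun i _ => Finset.sum_nonneg fun k _ => abs_nonneg _) (Finset.mem_univ i)

/-- If `z k ≤ p` for `k < i` and `|z i| ≤ p`, the drift sum is at most `rowBound * p`. -/
lemma sum_Iic_le_rowBound_mul {z : Fin m → ℝ} {i : Fin m} {p : ℝ}
    (hi : |z i| ≤ p) (h : ∀ k < i, z k ≤ p) :
    ∑ k ∈ Finset.Iic i, P.AV i k * z k ≤ P.rowBound * p := by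
  have hp : 0 ≤ p := (abs_nonneg _).trans hi
  refine sum_Iic_mul_le_rowBound_mul hp fun k hk => ?_
  -- Off-diagonal entries are nonnegative, so a one-sided bound suffices for `k < i`; the diagonal
  -- term uses the two-sided one.
  rcases (Finset.mem_Iic.1 hk).lt_or_eq with hlt | rfl
  · have h0 := P.AV_nonneg hlt.ne
    rw [abs_of_nonneg h0]
    exact mul_le_mul_of_nonneg_left (h k hlt) h0
  · refine (le_abs_self _).trans ?_
    rw [abs_mul]
    gcongr

/-- A priori lower bound for solutions of the Riccati system. -/
lemma neg_mul_exp_le_of_riccati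
    (hy : IsIntegralCurveOn y (fun _ q => P.homField q + c) (Ico 0 T)) {K : ℝ} (hK : 0 < K)
    (h0 : ∀ i, |y 0 i| ≤ K) (hc : ∀ i, |c i| ≤ K) (i : Fin m) :
    ∀ t ∈ Ico 0 T, -(K * Real.exp ((P.rowBound + 2) * t)) ≤ y t i := by
  induction i using WellFoundedLT.induction with
  | ind i ih =>
  intro t ht
  -- At contact the drift costs `rowBound * p` and the constant at most `p`; the remaining `p` makes
  -- the inequality strict. The square has the favourable sign.
  set L := P.rowBound + 2 with hL
  have hsub : ∀ s ∈ Icc 0 t, s ∈ Ico 0 T := fun s hs => ⟨hs.1, hs.2.trans_lt ht.2⟩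
  have key := image_le_of_deriv_right_lt_deriv_boundary (f := fun s => -y s i)
    (f' := fun s => -(P.homField (y s) i + c i)) (a := 0) (b := t)
    (B := fun s => K * Real.exp (L * s)) (B' := fun s => L * (K * Real.exp (L * s)))
    ((continuousOn_apply_of_riccati hy i).mono hsub).neg
    (fun s hs => (hasDerivWithinAt_Ici_of_riccati hy (hsub s ⟨hs.1, hs.2.le⟩) i).neg)
    (by simpa using neg_le.1 (neg_le_of_abs_le (h0 i)))
    (fun s => (((hasDerivAt_id s).const_mul L).exp.const_mul K).congr_deriv (by
      simp only [id]; ring))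
    (fun s hs he => by
      set p := K * Real.exp (L * s) with hp
      have hp0 : 0 < p := by positivity
      have hLs : 0 ≤ L * s := mul_nonneg (by linarith [P.rowBound_nonneg]) hs.1
      have hKp : K ≤ p := le_mul_of_one_le_right hK.le (Real.one_le_exp hLs)
      have h1 : ∑ k ∈ Finset.Iic i, P.AV i k * (-y s k) ≤ P.rowBound * p :=
        sum_Iic_le_rowBound_mul (by rw [he, abs_of_pos hp0]) fun k hk => by
          have := ih k hk s (hsub s ⟨hs.1, hs.2.le⟩)
          linarith
      simp only [mul_neg, Finset.sum_neg_distrib] at h1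
      have h2 := (abs_le.1 (hc i)).1
      have h3 : 0 ≤ (if i ∈ P.I then 1 / 2 * y s i ^ 2 else 0) := by
        split_ifs <;> positivity
      simp only [homField]
      rw [hL]
      nlinarith) ⟨ht.1, le_rfl⟩
  linarith

/-- A priori upper bound for the square-root coordinates, away from the terminal time. -/
lemma le_of_riccati_of_mem
    (hy : IsIntegralCurveOn y (fun _ q => P.homField q + c) (Ico 0 T)) {N : ℝ} (hN : 0 < N)
    (hc : ∀ i, |c i| ≤ N) (hlow : ∀ t ∈ Ico 0 T, ∀ i, -N ≤ y t i) {δ : ℝ} (hδ : 0 < δ)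
    {i : Fin m} (hi : i ∈ P.I) {t : ℝ} (ht : t ∈ Icc 0 (T - δ)) :
    y t i ≤ 8 * (P.rowBound + 1) + N + 8 / δ := by
  set Λ := P.rowBound + 1 with hΛ
  have hΛ1 : 1 ≤ Λ := by linarith [P.rowBound_nonneg]
  by_contra! hcon
  have h8 : 0 < 8 / δ := by positivity
  have hsub : ∀ s ∈ Icc t (T - δ / 2), s ∈ Ico 0 T := fun s hs =>
    ⟨ht.1.trans hs.1, by linarith [hs.2]⟩
  -- Above `8 Λ + N` the linear and constant terms absorb at most half of `y² / 2`. At least `δ / 2`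
  -- of time remains before `T - δ / 2`, so a value above `8 / δ` would blow up inside `[0, T)`.
  have key := mul_sub_lt_inv_of_sq_le_deriv (u := fun s => y s i)
    (u' := fun s => P.homField (y s) i + c i) (a := t) (b := T - δ / 2) (κ := 1 / 4)
    (M := 8 * Λ + N) (by linarith [ht.2]) (by norm_num) (by positivity)
    ((continuousOn_apply_of_riccati hy i).mono hsub)
    (fun s hs => hasDerivWithinAt_Ici_of_riccati hy (hsub s ⟨hs.1, hs.2.le⟩) i)
    (by linarith)
    (fun s hs hMs => by
      have hy0 : 0 < y s i := lt_of_lt_of_le (by positivity) hMs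
      have h1 : ∑ k ∈ Finset.Iic i, P.AV i k * (-y s k) ≤ P.rowBound * (y s i + N) :=
        sum_Iic_le_rowBound_mul (by rw [abs_neg, abs_of_pos hy0]; linarith) fun k hk => by
          have := hlow s (hsub s ⟨hs.1, hs.2.le⟩) k
          linarith
      simp only [mul_neg, Finset.sum_neg_distrib] at h1
      have h2 := (abs_le.1 (hc i)).1
      have h3 : (8 * Λ) * y s i ≤ y s i * y s i :=
        mul_le_mul_of_nonneg_right (by linarith) hy0.le
      have h4 : 8 * Λ * N ≤ 8 * Λ * y s i :=
        mul_le_mul_of_nonneg_left (by linarith) (by linarith)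
      have h5 : P.rowBound = Λ - 1 := by linarith
      rw [h5] at h1
      simp only [homField, if_pos hi]
      nlinarith)
  have h1 : (y t i)⁻¹ ≤ (8 / δ)⁻¹ := by
    apply inv_anti₀ h8
    linarith
  rw [inv_div] at h1
  linarith [ht.2]

/-- Solutions on `[0, T)` are bounded on `[0, T - δ]`, uniformly for bounded data. -/
lemma exists_forall_norm_le (P : CanonicalAffine m n) (hT : 0 < T) {K δ : ℝ} (hK : 0 < K)
    (hδ : 0 < δ) :
    ∃ C, ∀ (c : Fin m → ℝ) (y : ℝ → Fin m → ℝ),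
      IsIntegralCurveOn y (fun _ q => P.homField q + c) (Ico 0 T) → ‖y 0‖ ≤ K → ‖c‖ ≤ K →
      ∀ t ∈ Icc 0 (T - δ), ‖y t‖ ≤ C := by
  set L := P.rowBound + 2 with hL
  have hL0 : 0 < L := by linarith [P.rowBound_nonneg]
  set N := K * Real.exp (L * T) with hN
  have hKN : K ≤ N := le_mul_of_one_le_right hK.le (Real.one_le_exp (by positivity))
  set U := 8 * (P.rowBound + 1) + N + 8 / δ with hU
  have h8 : 0 < 8 / δ := by positivity
  have hNU : N ≤ U := by linarith [P.rowBound_nonneg]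
  have hU0 : 0 < U := by linarith
  refine ⟨U * Real.exp (L * T), fun c y hy h0 hc t ht => ?_⟩
  have hc' : ∀ i, |c i| ≤ K := fun i => (norm_le_pi_norm c i).trans hc
  have h0' : ∀ i, |y 0 i| ≤ K := fun i => (norm_le_pi_norm (y 0) i).trans h0
  have hlow : ∀ t ∈ Ico 0 T, ∀ i, -N ≤ y t i := fun t ht i => by
    refine le_trans ?_ (neg_mul_exp_le_of_riccati hy hK h0' hc' i t ht)
    rw [neg_le_neg_iff, hN]
    gcongr
    exact ht.2.le
  -- Coordinates in `I` are bounded by the blow-up argument alone; the others are linear and are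
  -- compared with an exponential, using the bounds on earlier coordinates.
  have hup : ∀ i, ∀ t ∈ Icc 0 (T - δ), y t i ≤ U * Real.exp (L * t) := by
    intro i
    induction i using WellFoundedLT.induction with
    | ind i ih =>
    intro t ht
    by_cases hi : i ∈ P.I
    · refine (le_of_riccati_of_mem hy (hK.trans_le hKN) (fun i => (hc' i).trans hKN) hlow hδ hi
        ht).trans (le_mul_of_one_le_right hU0.le (Real.one_le_exp ?_))
      exact mul_nonneg hL0.le ht.1
    · have hsub : ∀ s ∈ Icc 0 t, s ∈ Ico 0 T := fun s hs => ⟨hs.1, by linarith [hs.2, ht.2]⟩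
      have key := image_le_of_deriv_right_lt_deriv_boundary (f := fun s => y s i)
        (f' := fun s => P.homField (y s) i + c i) (a := 0) (b := t)
        (B := fun s => U * Real.exp (L * s)) (B' := fun s => L * (U * Real.exp (L * s)))
        ((continuousOn_apply_of_riccati hy i).mono hsub)
        (fun s hs => hasDerivWithinAt_Ici_of_riccati hy (hsub s ⟨hs.1, hs.2.le⟩) i)
        (by simpa using (le_of_abs_le (h0' i)).trans (hKN.trans hNU))
        (fun s => (((hasDerivAt_id s).const_mul L).exp.const_mul U).congr_deriv (by
          simp only [id]; ring))
        (fun s hs he => by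
          set p := U * Real.exp (L * s) with hp
          have hp0 : 0 < p := by positivity
          have hUp : U ≤ p :=
            le_mul_of_one_le_right hU0.le (Real.one_le_exp (mul_nonneg hL0.le hs.1))
          have h1 : ∑ k ∈ Finset.Iic i, P.AV i k * y s k ≤ P.rowBound * p :=
            sum_Iic_le_rowBound_mul (by rw [he, abs_of_pos hp0]) fun k hk =>
              ih k hk s ⟨hs.1, hs.2.le.trans ht.2⟩
          have h2 := (abs_le.1 (hc' i)).2
          simp only [homField, if_neg hi]
          rw [hL]
          nlinarith) ⟨ht.1, le_rfl⟩
      exact key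
  rw [pi_norm_le_iff_of_nonneg (by positivity)]
  intro i
  rw [Real.norm_eq_abs, abs_le]
  have htT : t < T := by linarith [ht.2]
  constructor
  · have h1 := hlow t ⟨ht.1, htT⟩ i
    have h2 : U ≤ U * Real.exp (L * T) :=
      le_mul_of_one_le_right hU0.le (Real.one_le_exp (by positivity))
    linarith
  · refine (hup i t ht).trans ?_
    gcongr

end CanonicalAffine

/-! ### Closedness, interior and boundary of the nonexplosion set. -/

namespace CanonicalAffine

variable {m n : ℕ} (P : CanonicalAffine m n) {T : ℝ}

/-- The pairs of an initial value and an inhomogeneity for which the Riccati system is solvable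
on `[0, T)`. -/
def solvableSet (T : ℝ) : Set ((Fin m → ℝ) × (Fin m → ℝ)) :=
  {p | ∃ y : ℝ → Fin m → ℝ, y 0 = p.1 ∧
    IsIntegralCurveOn y (fun _ q => P.homField q + p.2) (Ico 0 T)}

/-- `w` enters only through the vector `g w`, so topological properties can be proved for pairs `(v,
c)` and pulled back along a continuous map. -/
lemma nonexplosionSet_eq :
    P.nonexplosionSet T
      = (fun u : (Fin m → ℝ) × P.kerAD => (u.1, P.g u.2)) ⁻¹' P.solvableSet T := rfl

lemma continuous_prodMk_g :
    Continuous fun u : (Fin m → ℝ) × P.kerAD => (u.1, P.g u.2) :=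
  continuous_fst.prodMk (P.continuous_g.comp (continuous_subtype_val.comp continuous_snd))

lemma isClosed_solvableSet (hT : 0 < T) : IsClosed (P.solvableSet T) := by
  refine isClosed_of_closure_subset fun p hp => ?_
  refine P.locallyLipschitz_homField.exists_isIntegralCurveOn_Ico (fun b hb hbT => ?_) hT
  obtain ⟨C, hC⟩ := P.exists_forall_norm_le hT (K := ‖p‖ + 1) (δ := T - b) (by positivity)
    (by linarith)
  refine P.locallyLipschitz_homField.exists_isIntegralCurveOn_Icc_of_mem_closure hb C ?_
  -- Approximants in the unit ball have data bounded by `‖p‖ + 1`, which makes the a priori bound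
  -- uniform.
  have hp' : p ∈ closure (Metric.ball p 1 ∩ P.solvableSet T) :=
    Metric.isOpen_ball.inter_closure ⟨Metric.mem_ball_self one_pos, hp⟩
  refine closure_mono ?_ hp'
  rintro q ⟨hq, y, hy0, hy⟩
  have hqn : ‖q‖ ≤ ‖p‖ + 1 := by
    have h1 := norm_le_norm_add_norm_sub' q p
    have h2 := mem_ball_iff_norm.1 hq
    linarith
  refine ⟨y, hy0, hy.mono (Icc_subset_Ico_right hbT), fun t ht => ?_⟩
  exact hC q.2 y hy (hy0 ▸ (norm_fst_le q).trans hqn) ((norm_snd_le q).trans hqn) t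
    (by simpa using ht)

variable {P}

/-- Convergence to `0` brings `‖x‖` below `1 / T`, hence `y i ≤ 1 / (T - t)` near `T`, which already
forces boundedness and extension to `T`. Conversely, `e^{-s}` times a bounded curve tends to `0`. -/
lemma mem_stableSet_zero_iff (hT : 0 < T) {w : P.kerAD} {v : Fin m → ℝ} :
    v ∈ P.stableSet T w 0 ↔ ∃ y : ℝ → Fin m → ℝ, y 0 = v ∧
      IsIntegralCurveOn y (fun _ q => P.homField q + P.g w) (Icc 0 T) := by
  constructor
  · rintro ⟨x, hx0, hx, hlim⟩
    have hX := isIntegralCurveOn_fst hx0 hx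
    have hY := isIntegralCurveOn_riccati_of_timeField hT hX
    set Y : ℝ → Fin m → ℝ := fun t => (T / (T - t)) • (x (-Real.log ((T - t) / T))).1 with hYdef
    have hY0 : Y 0 = v := by simp [hYdef, hT.ne', hx0]
    have hXlim : Tendsto (fun s => (x s).1) atTop (𝓝 0) :=
      (continuous_fst.tendsto _).comp hlim
    have hsmall : ∀ᶠ s in atTop, ‖(x s).1‖ < 1 / T := by
      have := hXlim.norm
      rw [norm_zero] at this
      exact this.eventually_lt_const (by positivity)
    obtain ⟨S, hS⟩ := eventually_atTop.1 (hsmall.and (eventually_ge_atTop 0))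
    have hS0 : 0 ≤ S := (hS S le_rfl).2
    have he1 : Real.exp (-S) ≤ 1 := Real.exp_le_one_iff.2 (by linarith)
    have hepos := Real.exp_pos (-S)
    obtain ⟨K, hK⟩ := exists_norm_le_of_le_inv_sub hY (S := T * (1 - Real.exp (-S)))
      ⟨mul_nonneg hT.le (by linarith), by nlinarith⟩ (fun t ht i => by
        have hTt : 0 < T - t := by linarith [ht.2]
        have h1 : S ≤ -Real.log ((T - t) / T) := by
          rw [le_neg, Real.log_le_iff_le_exp (by positivity), div_le_iff₀ hT]
          linarith [ht.1]
        have h2 := (hS _ h1).1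
        have h3 := (le_abs_self _).trans ((norm_le_pi_norm _ i).trans h2.le)
        simp only [hYdef, Pi.smul_apply, smul_eq_mul]
        have h4 := mul_le_mul_of_nonneg_left h3 (show 0 ≤ T / (T - t) by positivity)
        refine h4.trans (le_of_eq ?_)
        field_simp)
    exact P.locallyLipschitz_homField.exists_isIntegralCurveOn_Icc_of_bounded hT hY0 hY hK
  · rintro ⟨y, hy0, hy⟩
    have hX := isIntegralCurveOn_timeField_of_riccati hT (hy.mono Ico_subset_Icc_self)
    refine ⟨_, by simp [hy0], isIntegralCurveOn_prod hX, ?_⟩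
    refine Tendsto.prodMk_nhds ?_ Real.tendsto_exp_neg_atTop_nhds_zero
    obtain ⟨K, hK⟩ := hy.exists_norm_le
    have hlim : Tendsto (fun s => Real.exp (-s) * K) atTop (𝓝 0) := by
      simpa using Real.tendsto_exp_neg_atTop_nhds_zero.mul_const K
    refine squeeze_zero_norm' ?_ hlim
    filter_upwards [eventually_ge_atTop 0] with s hs
    rw [norm_smul, Real.norm_of_nonneg (Real.exp_pos _).le]
    refine mul_le_mul_of_nonneg_left (hK _ ?_) (Real.exp_pos _).le
    have h1 : Real.exp (-s) ≤ 1 := Real.exp_le_one_iff.2 (by linarith)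
    have h2 := Real.exp_pos (-s)
    constructor
    · exact mul_nonneg hT.le (by linarith)
    · nlinarith

lemma mem_nonexplosionSet_of_mem_stableSet (hT : 0 < T) {w : P.kerAD} {v ν : Fin m → ℝ}
    (h : v ∈ P.stableSet T w ν) : (v, w) ∈ P.nonexplosionSet T := by
  obtain ⟨x, hx0, hx, -⟩ := h
  exact ⟨_, by simp [hT.ne', hx0],
    isIntegralCurveOn_riccati_of_timeField hT (isIntegralCurveOn_fst hx0 hx)⟩

lemma exists_mem_stableSet (hT : 0 < T) {u : (Fin m → ℝ) × P.kerAD}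
    (h : u ∈ P.nonexplosionSet T) :
    ∃ ν : Fin m → ℝ, (∀ i, ν i = 0 ∨ (i ∈ P.I ∧ ν i = 2 / T)) ∧ u.1 ∈ P.stableSet T u.2 ν := by
  obtain ⟨y, hy0, hy⟩ := h
  have hX := isIntegralCurveOn_timeField_of_riccati (c := P.g u.2) hT hy
  obtain ⟨ν, hν, hlim⟩ := exists_tendsto_of_timeField hT hX
  exact ⟨ν, hν, _, by simp [hy0], isIntegralCurveOn_prod hX,
    hlim.prodMk_nhds Real.tendsto_exp_neg_atTop_nhds_zero⟩

lemma notMem_interior_of_mem_stableSet (hT : 0 < T) {w : P.kerAD} {v ν : Fin m → ℝ}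
    (h : v ∈ P.stableSet T w ν) {i : Fin m} (hi : i ∈ P.I) (hν : ν i = 2 / T) :
    (v, w) ∉ interior (P.nonexplosionSet T) := by
  intro hint
  -- An interior point could be moved a little along `(1, …, 1)`, which raises every initial
  -- coordinate.
  have hcont : Continuous fun r : ℝ => ((v + fun _ => r, w) : (Fin m → ℝ) × P.kerAD) := by
    fun_prop
  have hev : ∀ᶠ r in 𝓝 (0 : ℝ), (v + fun _ => r, w) ∈ P.nonexplosionSet T := by
    refine hcont.continuousAt.eventually_mem ?_
    have hv : (v + fun _ => (0 : ℝ)) = v := add_zero v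
    rw [hv]
    exact mem_interior_iff_mem_nhds.1 hint
  obtain ⟨r, hr, hr0⟩ := ((hev.filter_mono nhdsWithin_le_nhds).and
    (self_mem_nhdsWithin (a := (0 : ℝ)) (s := Ioi 0))).exists
  obtain ⟨ν', -, z, hz0, hz, hzlim⟩ := exists_mem_stableSet hT hr
  obtain ⟨x, hx0, hx, hxlim⟩ := h
  refine not_tendsto_of_initial_lt hT (isIntegralCurveOn_fst hx0 hx) (isIntegralCurveOn_fst hz0 hz)
    (fun j => ?_) ((continuous_fst.tendsto _).comp hxlim) ((continuous_fst.tendsto _).comp hzlim)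
    hi hν
  simpa [hx0, hz0] using hr0

lemma equilibria_eq (hT : 0 < T) (w : P.kerAD) :
    P.equilibria T w = {x | (∀ i, x.1 i = 0 ∨ (i ∈ P.I ∧ x.1 i = 2 / T)) ∧ x.2 = 0} := by
  ext ⟨x, r⟩
  simp only [equilibria, transformedField, mem_ofPred_eq, Prod.mk_eq_zero, neg_eq_zero]
  refine and_congr_left fun hr => ?_
  subst hr
  rw [funext_iff]
  refine forall_congr' fun i => ?_
  by_cases hi : i ∈ P.I
  · have h1 : T / 2 * x i ^ 2 - x i = x i * (T / 2) * (x i - 2 / T) := by field_simp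
    simp [hi, h1, hT.ne', sub_eq_zero]
  · simp [hi]

lemma iUnion_stableSet_zero_subset (hT : 0 < T) :
    (⋃ w : P.kerAD, P.stableSet T w 0 ×ˢ {w}) ⊆ interior (P.nonexplosionSet T) := by
  refine interior_maximal ?_ ?_
  · refine iUnion_subset fun w => ?_
    rintro ⟨v, w'⟩ ⟨hv, rfl⟩
    exact mem_nonexplosionSet_of_mem_stableSet hT hv
  -- The union is the preimage of the data solvable on closed `[0, T]`, an open set.
  · have : (⋃ w : P.kerAD, P.stableSet T w 0 ×ˢ {w})
        = (fun u : (Fin m → ℝ) × P.kerAD => (u.1, P.g u.2)) ⁻¹'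
          {p | ∃ y : ℝ → Fin m → ℝ, y 0 = p.1 ∧
            IsIntegralCurveOn y (fun _ q => P.homField q + p.2) (Icc 0 T)} := by
      ext ⟨v, w⟩
      simp [mem_stableSet_zero_iff hT]
    rw [this]
    exact (P.locallyLipschitz_homField.isOpen_setOf_exists_isIntegralCurveOn_Icc hT.le).preimage
      P.continuous_prodMk_g

lemma interior_nonexplosionSet (hT : 0 < T) :
    interior (P.nonexplosionSet T) = ⋃ w : P.kerAD, P.stableSet T w 0 ×ˢ {w} := by
  refine Subset.antisymm (fun u hu => ?_) (iUnion_stableSet_zero_subset hT)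
  obtain ⟨ν, hν, hmem⟩ := exists_mem_stableSet hT (interior_subset hu)
  have hν0 : ν = 0 := by
    funext i
    refine (hν i).resolve_right fun hi => ?_
    exact notMem_interior_of_mem_stableSet hT hmem hi.1 hi.2 hu
  subst hν0
  exact mem_iUnion.2 ⟨u.2, hmem, rfl⟩

lemma frontier_nonexplosionSet (hT : 0 < T) :
    frontier (P.nonexplosionSet T) = ⋃ w : P.kerAD,
      (⋃ ν ∈ (Prod.fst '' P.equilibria T w) \ {0}, P.stableSet T w ν) ×ˢ {w} := by
  have hcl : IsClosed (P.nonexplosionSet T) :=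
    P.nonexplosionSet_eq ▸ (P.isClosed_solvableSet hT).preimage P.continuous_prodMk_g
  rw [hcl.frontier_eq]
  ext ⟨v, w⟩
  simp only [equilibria_eq hT, mem_iUnion, mem_prod, mem_singleton_iff, exists_prop]
  constructor
  · rintro ⟨hmem, hint⟩
    obtain ⟨ν, hν, hs⟩ := exists_mem_stableSet hT hmem
    refine ⟨w, ⟨ν, ⟨⟨(ν, 0), ⟨hν, rfl⟩, rfl⟩, ?_⟩, hs⟩, rfl⟩
    rintro rfl
    exact hint (iUnion_stableSet_zero_subset hT (mem_iUnion.2 ⟨w, hs, rfl⟩))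
  · rintro ⟨w', ⟨ν, ⟨⟨⟨ν', r⟩, ⟨hν, -⟩, rfl⟩, hne⟩, hs⟩, rfl⟩
    refine ⟨mem_nonexplosionSet_of_mem_stableSet hT hs, ?_⟩
    obtain ⟨i, hi⟩ := Function.ne_iff.1 hne
    have hi' := (hν i).resolve_left hi
    exact notMem_interior_of_mem_stableSet hT hs hi'.1 hi'.2

end CanonicalAffine

end

theorem theorem3p9 {m n : ℕ} (P : CanonicalAffine m n) (T : ℝ) (hT : 0 < T) :
    interior (P.nonexplosionSet T)
        = ⋃ w : P.kerAD, P.stableSet T w 0 ×ˢ {w} ∧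
      frontier (P.nonexplosionSet T)
        = ⋃ w : P.kerAD,
            (⋃ ν ∈ (Prod.fst '' P.equilibria T w) \ {0}, P.stableSet T w ν) ×ˢ {w} ∧
      ∀ w : P.kerAD, P.equilibria T w
        = {x | (∀ i, x.1 i = 0 ∨ (i ∈ P.I ∧ x.1 i = 2 / T)) ∧ x.2 = 0} :=
  ⟨CanonicalAffine.interior_nonexplosionSet hT, CanonicalAffine.frontier_nonexplosionSet hT,
    fun w => CanonicalAffine.equilibria_eq hT w⟩
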